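/- Let $0\le k\le n$. For $w\in S_n$ let $\ell(w)$ be its number of inversions and put $\sigma_k(w)=w(\{1,\dots,k\})$. Let $\le$ be the Bruhat order on $S_n$, with covers $\lessdot$ and intervals $[u,w]$. Let $\le_k$ be the $k$-Bruhat order, i.e. the reflexive and transitive closure of the relations $u\lessdot_k w$, which hold when $u\lessdot w$ and $\sigma_k(u)\ne\sigma_k(w)$. Write $\sigma_k(\Delta([u,w]))$ for the simplicial complex whose faces are the sets $\sigma_k(C)=\{\sigma_k(v):v\in C\}$ for $C$ a (possibly empty) chain of $[u,w]$ in Bruhat order; a face with $d+1$ vertices has dimension $d$. Let $\mathcal Q(k,n)$ be the set of equivalence classes $\langle u,w\rangle$ of intervals $[u,w]_k$ of the $k$-Bruhat order ($u\le_k w$), for the equivalence relation generated by $[u,w]_k\sim[uz,wz]_k$ whenever $u\le_k w$, $uz\le_k wz$, $z\in S_k\times S_{n-k}$, $\ell(uz)=\ell(u)+\ell(z)$ and $\ell(wz)=\ell(w)+\ell(z)$. Order $\mathcal Q(k,n)$ by: $q\le q'$ if and only if there are representatives $[u,w]_k\in q$ and $[u',w']_k\in q'$ with $[u',w']\subseteq[u,w]$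 (so larger classes have smaller intervals); $q<q'$ means $q\le q'$ and $q\ne q'$. **Lemma.** Let $u\le_k w$. A face of $\sigma_k(\Delta([u,w]))$ of dimension $\ell(w)-\ell(u)-1$ is called a *ridge*. 1. Every ridge $F$ of $\sigma_k(\Delta([u,w]))$ lies in exactly one or exactly two $(\ell(w)-\ell(u))$-dimensional faces of $\sigma_k(\Delta([u,w]))$; it is called *exterior* or *interior* respectively. 2. Let $u'\le_k w'$ with $\langle u',w'\rangle>\langle u,w\rangle$ in $\mathcal Q(k,n)$. Then every face $F$ of $\sigma_k(\Delta([u',w']))$ lies in (is contained in) an exterior ridge of $\sigma_k(\Delta([u,w]))$. In particular, every ridge of $\sigma_k(\Delta([u,w]))$ that is a face of $\sigma_k(\Delta([u',w']))$ is exterior. -/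

import Mathlib

open Finset

namespace Positroid

noncomputable section

/-- Permutations of `[n]`, modelled on `Fin n` (so `[k]` is `{i | i.val < k}`).
`u * w` is the permutation `i ↦ u (w i)`. -/
abbrev S (n : ℕ) : Type := Equiv.Perm (Fin n)

/-- The length of a permutation: its number of inversions. -/
def len {n : ℕ} (w : S n) : ℕ :=
  (univ.filter fun p : Fin n × Fin n => p.1 < p.2 ∧ w p.2 < w p.1).card

/-- `σ_k(w) = w([k])`. -/
def sigma {n : ℕ} (k : ℕ) (w : S n) : Finset (Fin n) :=
  (univ.filter fun i : Fin n => i.val < k).image w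

/-- `v` is obtained from `u` by right multiplication with a transposition that increases the
length. -/
def BruhatStep {n : ℕ} (u v : S n) : Prop :=
  ∃ i j : Fin n, v = u * Equiv.swap i j ∧ len u < len v

/-- The (strong) Bruhat order `u ≤ v`. -/
def BruhatLE {n : ℕ} (u v : S n) : Prop :=
  Relation.ReflTransGen BruhatStep u v

/-- Strict Bruhat order `u < v`. -/
def BruhatLT {n : ℕ} (u v : S n) : Prop :=
  BruhatLE u v ∧ u ≠ v

/-- Covers `u ⋖ v` in Bruhat order. -/
def BruhatCov {n : ℕ} (u v : S n) : Prop :=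
  BruhatLT u v ∧ ∀ x : S n, BruhatLT u x → ¬ BruhatLT x v

/-- The `k`-covers `u ⋖_k v`: Bruhat covers whose images under `σ_k` differ. -/
def KCov {n : ℕ} (k : ℕ) (u v : S n) : Prop :=
  BruhatCov u v ∧ sigma k u ≠ sigma k v

/-- The `k`-Bruhat order `u ≤_k v`. -/
def KLE {n : ℕ} (k : ℕ) (u v : S n) : Prop :=
  Relation.ReflTransGen (KCov k) u v

/-- The Bruhat interval `[u,w]`. -/
def interval {n : ℕ} (u w : S n) : Set (S n) :=
  {v | BruhatLE u v ∧ BruhatLE v w}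

/-! ### Simplicial complexes, given by their sets of faces

The empty set is a face (the empty chain), of dimension `-1`. -/

/-- The faces of the order complex `Δ(P)` of the subset `P` of a type ordered by `r`:
the finite chains of `P`. -/
def orderComplex {α : Type*} (r : α → α → Prop) (P : Set α) : Set (Finset α) :=
  {C | (C : Set α) ⊆ P ∧ IsChain r (C : Set α)}

/-- The image `p(K)` of a complex under a map of vertices. -/
def imageComplex {α β : Type*} [DecidableEq β] (p : α → β) (K : Set (Finset α)) :
    Set (Finset β) :=
  (fun C => C.image p) '' K

/-- The dimension of a face. -/
def dim {α : Type*} (F : Finset α) : ℤ := (F.card : ℤ) - 1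

/-- The set of faces of `σ_k(Δ([u,w]))`. -/
def sigmaComplex {n : ℕ} (k : ℕ) (u w : S n) : Set (Finset (Finset (Fin n))) :=
  imageComplex (sigma k) (orderComplex BruhatLE (interval u w))

/-- The `(ℓ(w) - ℓ(u))`-dimensional faces of `σ_k(Δ([u,w]))` that contain `F`. -/
def topFacesOver {n : ℕ} (k : ℕ) (u w : S n) (F : Finset (Finset (Fin n))) :
    Set (Finset (Finset (Fin n))) :=
  {G | G ∈ sigmaComplex k u w ∧ dim G = (len w : ℤ) - len u ∧ F ⊆ G}

/-- Ridges of `σ_k(Δ([u,w]))`: the faces of dimension `ℓ(w) - ℓ(u) - 1`. -/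
def IsRidge {n : ℕ} (k : ℕ) (u w : S n) (F : Finset (Finset (Fin n))) : Prop :=
  F ∈ sigmaComplex k u w ∧ dim F = (len w : ℤ) - len u - 1

/-- Exterior ridges: those that lie in exactly one top-dimensional face. -/
def IsExteriorRidge {n : ℕ} (k : ℕ) (u w : S n) (F : Finset (Finset (Fin n))) : Prop :=
  IsRidge k u w F ∧ (topFacesOver k u w F).ncard = 1

/-- Interior ridges: those that lie in exactly two top-dimensional faces. -/
def IsInteriorRidge {n : ℕ} (k : ℕ) (u w : S n) (F : Finset (Finset (Fin n))) : Prop :=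
  IsRidge k u w F ∧ (topFacesOver k u w F).ncard = 2

/-! ### The poset `Q(k,n)` -/

/-- The `k`-Bruhat intervals `[u,w]_k`, given by their endpoints `u ≤_k w`. -/
def KInterval (k n : ℕ) : Type := {p : S n × S n // KLE k p.1 p.2}

/-- Membership in the parabolic subgroup `S_k × S_{n-k}`. -/
def IsParabolic {n : ℕ} (k : ℕ) (z : S n) : Prop :=
  ∀ i : Fin n, (z i).val < k ↔ i.val < k

/-- The relations generating `∼`: `[u,w]_k` is related to `[uz,wz]_k` when `z ∈ S_k × S_{n-k}` and
both products are length-additive. -/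
def KIntervalRel (k n : ℕ) (p q : KInterval k n) : Prop :=
  ∃ z : S n, IsParabolic k z ∧
    q.1.1 = p.1.1 * z ∧ len q.1.1 = len p.1.1 + len z ∧
    q.1.2 = p.1.2 * z ∧ len q.1.2 = len p.1.2 + len z

/-- `Q(k,n)`: the `k`-Bruhat intervals modulo the equivalence relation generated by
`KIntervalRel` (`Quot` is the quotient by the generated equivalence relation). -/
def Q (k n : ℕ) : Type := Quot (KIntervalRel k n)

/-- The class `⟨u,w⟩` of `[u,w]_k`. -/
def Q.mk {k n : ℕ} (u w : S n) (h : KLE k u w) : Q k n :=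
  Quot.mk _ ⟨(u, w), h⟩

/-- The order on `Q(k,n)`: `q ≤ q'` if there are representatives `[u,w]_k` of `q` and `[u',w']_k`
of `q'` with `[u',w'] ⊆ [u,w]`. Larger classes have smaller intervals, so the rank of `⟨u,w⟩` is
`k(n-k) - (ℓ(w) - ℓ(u))`. -/
def Q.le {k n : ℕ} (q q' : Q k n) : Prop :=
  ∃ (u w u' w' : S n) (h : KLE k u w) (h' : KLE k u' w'),
    Q.mk u w h = q ∧ Q.mk u' w' h' = q' ∧ interval u' w' ⊆ interval u w

/-- The strict order on `Q(k,n)`. -/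
def Q.lt {k n : ℕ} (q q' : Q k n) : Prop :=
  Q.le q q' ∧ q ≠ q'

end

end Positroid

/-!
The argument is combinatorial and rests on the lifting property of Bruhat order: for an adjacent
transposition `s`, the maps `u ↦ min(u, us)` and `u ↦ max(u, us)` are monotone (`dn_mono`,
`up_mono`). It gives that Bruhat order is graded and thin (`BruhatLE.exists_cov_right`,
`exists_two_between`) and, in its left-handed form, Deodhar's lemma: the elements of a coset of
`S_k × S_{n-k}` that lie above a given permutation have a least one (`exists_least_in_coset`). In
particular a `k`-cover of `x` is determined by its coset, and lies below every element above `x`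
in that coset.

*Reduction.* If `s` lies in `S_k × S_{n-k}`, the two monotone maps preserve `σ_k`, so
`σ_k(Δ([u,w]))` does not change when `[u,w]` is replaced by `[us,ws]` with `us < u` and `ws < w`.
Hence the complex depends only on the class `⟨u,w⟩` (`sigmaComplex_eq_of_mk_eq`), and since the
descents of `w` inside a block are descents of every `u ≤_k w`, one may assume that `w` is
Grassmannian, that is, the least element of its coset (`exists_isGrass`).

*Ridges.* Let `l = ℓ(w) - ℓ(u)`. A ridge is the image of a chain of `l` elements of `[u,w]`, one
from each coset `I_0, …, I_{l-1}`, with all lengths but one, the gap. Below the gap the chain is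
determined by `u` and the cosets, above it by `w` and the cosets, so there is at most one chain
for each position of the gap. By thinness a gap that is not at an end of `[u,w]` can be filled in
two ways. A filling from one of the two neighbouring cosets shows that the gap can be moved by one
place, and any other filling gives a facet over the ridge. By Deodhar's lemma the possible
positions form an interval `[q,p]` of `[0,l]`, and all adjacent positions are connected in this
way. Hence for `l > 0` the number of facets over the ridge is `[0 < q] + [p < l]`
(`exists_ncard_topFacesOver`). If `w` is Grassmannian, `q = 0` and `p = l` do not both occur,
which leaves one or two facets (`IsGrass.ncard_topFacesOver`), and one facet exactly if the gap
can be at an end, as happens when the ridge is the image of a chain in a proper subinterval of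
`[u,w]` (`IsGrass.ncard_topFacesOver_of_isProperFace`).

*Faces of smaller intervals.* It remains to see that a face that comes from a proper subinterval
of `[u,w]` lies in a ridge that does (`IsGrass.exists_isProperFace`). In a saturated chain, a step
inside a coset that is adjacent to a step between cosets can be exchanged with it by thinness,
either moving the step inside the coset or producing a new coset. Moving such steps up proves that
the complex of `[u,w]` is pure for Grassmannian `w` (`IsGrass.exists_facet`). Moving them down
shows that a maximal face for an arbitrary interval `[u,v]` has full dimension or comes from a
chain that avoids `u` (`card_eq_or_mem_of_maximal`).
-/

namespace Positroid

variable {n k : ℕ}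

/-! ### Bruhat order and length -/

theorem len_lt_len_mul_swap {u : S n} {i j : Fin n} (hij : i < j) (hu : u i < u j) :
    len u < len (u * Equiv.swap i j) := by
  classical
  -- The inversion `(p, q)` of `u` is sent to `(t p, t q)` or, if `t` reverses it, to itself.
  set t := Equiv.swap i j with ht
  have hti : t i = j := Equiv.swap_apply_left i j
  have htj : t j = i := Equiv.swap_apply_right i j
  have htt : ∀ x, t (t x) = x := fun x => Equiv.swap_apply_self i j x
  have hto : ∀ x, x ≠ i → x ≠ j → t x = x := fun x h1 h2 => Equiv.swap_apply_of_ne_of_ne h1 h2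
  let f : Fin n × Fin n → Fin n × Fin n := fun p => if t p.1 < t p.2 then (t p.1, t p.2) else p
  let A : Finset (Fin n × Fin n) := univ.filter fun p => p.1 < p.2 ∧ u p.2 < u p.1
  let B : Finset (Fin n × Fin n) :=
    univ.filter fun p => p.1 < p.2 ∧ (u * t) p.2 < (u * t) p.1
  have hA : ∀ p, p ∈ A ↔ p.1 < p.2 ∧ u p.2 < u p.1 := by intro p; simp [A]
  have hB : ∀ p, p ∈ B ↔ p.1 < p.2 ∧ u (t p.2) < u (t p.1) := fun p =>
    mem_filter.trans (and_iff_right (mem_univ _))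
  have hmaps : ∀ p ∈ A, f p ∈ B.erase (i, j) := by
    rintro ⟨p, q⟩ hp
    obtain ⟨h1, h2⟩ := (hA _).1 hp
    simp only at h1 h2
    rw [mem_erase, hB]
    simp only [f]
    split_ifs with h
    · refine ⟨?_, h, by simpa [htt] using h2⟩
      intro h'
      rw [Prod.mk.injEq] at h'
      have e1 : p = j := by rw [← htt p, h'.1, hti]
      have e2 : q = i := by rw [← htt q, h'.2, htj]
      subst e1 e2
      exact absurd hij (not_lt.2 h1.le)
    · refine ⟨?_, h1, ?_⟩
      · intro h'
        rw [Prod.mk.injEq] at h'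
        rw [h'.1, h'.2] at h2
        exact absurd h2 (not_lt.2 hu.le)
      · simp only
        by_cases p1 : p = i
        · by_cases q2 : q = j
          · subst p1 q2; exact absurd h2 (not_lt.2 hu.le)
          · have q1 : q ≠ i := by rintro rfl; exact absurd p1 h1.ne
            rw [p1, hti, hto q q1 q2]
            rw [p1] at h2
            exact h2.trans hu
        · by_cases p2 : p = j
          · have q1 : q ≠ i := by rintro rfl; rw [p2] at h1; exact absurd hij (not_lt.2 h1.le)
            have q2 : q ≠ j := by rintro rfl; exact absurd p2 h1.ne
            rw [p2, htj, hto q q1 q2] at h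
            rw [p2] at h1
            exact absurd (hij.trans h1) h
          · rw [hto p p1 p2] at h ⊢
            by_cases q1 : q = i
            · rw [q1] at h1 h
              rw [hti] at h
              exact absurd (h1.trans hij) h
            · by_cases q2 : q = j
              · rw [q2, htj]
                rw [q2] at h2
                exact hu.trans h2
              · rw [hto q q1 q2] at h
                exact absurd h1 h
  have hinj : Set.InjOn f A := by
    rintro ⟨p, q⟩ hp ⟨p', q'⟩ hp' h
    have h1 := ((hA _).1 hp).1
    have h1' := ((hA _).1 hp').1
    simp only at h1 h1'
    simp only [f] at h
    split_ifs at h with c c' c'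
    · rw [Prod.mk.injEq] at h
      rw [t.injective h.1, t.injective h.2]
    · rw [Prod.mk.injEq] at h
      rw [← h.1, ← h.2, htt, htt] at c'
      exact absurd h1 c'
    · rw [Prod.mk.injEq] at h
      rw [h.1, h.2, htt, htt] at c
      exact absurd h1' c
    · exact h
  have hmem : (i, j) ∈ B := by
    rw [hB]; simp only; rw [hti, htj]; exact ⟨hij, hu⟩
  calc len u = A.card := rfl
    _ ≤ (B.erase (i, j)).card := card_le_card_of_injOn f hmaps hinj
    _ < B.card := card_erase_lt_of_mem hmem
    _ = len (u * t) := rfl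

theorem bruhatStep_iff {u v : S n} :
    BruhatStep u v ↔ ∃ i j : Fin n, i < j ∧ u i < u j ∧ v = u * Equiv.swap i j := by
  constructor
  · rintro ⟨i, j, rfl, h⟩
    have key : ∀ i j : Fin n, i < j → len u < len (u * Equiv.swap i j) → u i < u j := by
      intro i j hij h
      by_contra hc
      have hne : u i ≠ u j := fun e => hij.ne (u.injective e)
      have hlt : u j < u i := lt_of_le_of_ne (not_lt.1 hc) hne.symm
      have := len_lt_len_mul_swap (u := u * Equiv.swap i j) hij (by simpa using hlt)
      rw [mul_assoc, Equiv.swap_mul_self, mul_one] at this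
      omega
    rcases lt_trichotomy i j with hij | rfl | hij
    · exact ⟨i, j, hij, key i j hij h, rfl⟩
    · simp [Equiv.swap_self] at h
      exact absurd h (lt_irrefl _)
    · rw [Equiv.swap_comm] at h ⊢
      exact ⟨j, i, hij, key j i hij h, rfl⟩
  · rintro ⟨i, j, hij, hu, rfl⟩
    exact ⟨i, j, rfl, len_lt_len_mul_swap hij hu⟩

theorem BruhatLE.refl (u : S n) : BruhatLE u u := Relation.ReflTransGen.refl

theorem BruhatLE.trans {u v w : S n} (h : BruhatLE u v) (h' : BruhatLE v w) : BruhatLE u w :=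
  Relation.ReflTransGen.trans h h'

theorem BruhatStep.le {u v : S n} (h : BruhatStep u v) : BruhatLE u v :=
  Relation.ReflTransGen.single h

theorem BruhatStep.len_lt {u v : S n} (h : BruhatStep u v) : len u < len v := by
  obtain ⟨_, _, _, h⟩ := h
  exact h

theorem BruhatLE.eq_or_len_lt {u v : S n} (h : BruhatLE u v) : u = v ∨ len u < len v := by
  induction h with
  | refl => exact Or.inl rfl
  | tail _ hs ih =>
    right
    rcases ih with rfl | ih
    · exact hs.len_lt
    · exact ih.trans hs.len_lt

theorem BruhatLE.len_le {u v : S n} (h : BruhatLE u v) : len u ≤ len v := by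
  rcases h.eq_or_len_lt with rfl | h
  · exact le_rfl
  · exact h.le

theorem BruhatLE.eq_of_len_le {u v : S n} (h : BruhatLE u v) (hl : len v ≤ len u) : u = v := by
  rcases h.eq_or_len_lt with h | h
  · exact h
  · omega

theorem BruhatLE.antisymm {u v : S n} (h : BruhatLE u v) (h' : BruhatLE v u) : u = v :=
  h.eq_of_len_le h'.len_le

theorem BruhatLE.len_lt {u v : S n} (h : BruhatLE u v) (hne : u ≠ v) : len u < len v :=
  h.eq_or_len_lt.resolve_left hne

/-! ### Multiplication by an adjacent transposition -/

section Simple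

variable {a b : Fin n}

theorem simple_lt_simple (hab : b.val = a.val + 1) {i j : Fin n} (hij : i < j)
    (h : ¬ (i = a ∧ j = b)) : Equiv.swap a b i < Equiv.swap a b j := by
  simp only [Equiv.swap_apply_def, Fin.lt_def, Fin.ext_iff] at *
  split_ifs <;> omega

theorem mul_simple_apply_lt_iff (u : S n) :
    (u * Equiv.swap a b) a < (u * Equiv.swap a b) b ↔ u b < u a := by
  simp

theorem mul_simple_mul_simple (u : S n) : u * Equiv.swap a b * Equiv.swap a b = u := by
  rw [mul_assoc, Equiv.swap_mul_self, mul_one]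

theorem not_apply_lt_iff (hab : b.val = a.val + 1) (u : S n) : ¬ u a < u b ↔ u b < u a := by
  have : u a ≠ u b := fun e => by
    have := u.injective e
    rw [this] at hab
    omega
  rw [not_lt]
  exact ⟨fun h => lt_of_le_of_ne h this.symm, le_of_lt⟩

theorem len_mul_simple (hab : b.val = a.val + 1) {u : S n} (hu : u a < u b) :
    len (u * Equiv.swap a b) = len u + 1 := by
  classical
  -- All inversions except the new one at `(a, b)` correspond under the transposition.
  have hlt : a < b := by rw [Fin.lt_def]; omega
  set t := Equiv.swap a b with ht
  have htt : ∀ x, t (t x) = x := fun x => Equiv.swap_apply_self a b x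
  have hta : t a = b := Equiv.swap_apply_left a b
  have htb : t b = a := Equiv.swap_apply_right a b
  have : (univ.filter fun p : Fin n × Fin n => p.1 < p.2 ∧ (u * t) p.2 < (u * t) p.1) =
      insert (a, b) ((univ.filter fun p : Fin n × Fin n => p.1 < p.2 ∧ u p.2 < u p.1).image
        fun p => (t p.1, t p.2)) := by
    ext ⟨p, q⟩
    rw [mem_filter, mem_insert, mem_image]
    simp only [mem_filter, mem_univ, true_and, Prod.mk.injEq, Equiv.Perm.mul_apply, Prod.exists]
    constructor
    · rintro ⟨h1, h2⟩
      by_cases h : p = a ∧ q = b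
      · exact Or.inl h
      · exact Or.inr ⟨t p, t q, ⟨simple_lt_simple hab h1 h, h2⟩, htt p, htt q⟩
    · rintro (⟨rfl, rfl⟩ | ⟨p', q', ⟨h1, h2⟩, rfl, rfl⟩)
      · rw [hta, htb]; exact ⟨hlt, hu⟩
      · refine ⟨simple_lt_simple hab h1 ?_, by rwa [htt, htt]⟩
        rintro ⟨rfl, rfl⟩
        exact absurd h2 (not_lt.2 hu.le)
  unfold len
  rw [this, card_insert_of_notMem, card_image_of_injective]
  · rintro ⟨p, q⟩ ⟨p', q'⟩ h
    simpa using h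
  · simp only [mem_image, mem_filter, mem_univ, true_and, Prod.mk.injEq, Prod.exists, not_exists,
      not_and, and_imp]
    intro p q h1 h2 e1 e2
    have e1 : p = b := by rw [← htt p, e1, hta]
    have e2 : q = a := by rw [← htt q, e2, htb]
    rw [e1, e2] at h1
    exact absurd hlt (not_lt.2 h1.le)

theorem len_mul_simple_of_gt (hab : b.val = a.val + 1) {u : S n} (hu : u b < u a) :
    len (u * Equiv.swap a b) + 1 = len u := by
  have := len_mul_simple hab ((mul_simple_apply_lt_iff (a := a) (b := b) u).2 hu)
  rw [mul_simple_mul_simple] at this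
  exact this.symm

theorem le_mul_simple (hab : b.val = a.val + 1) {u : S n} (hu : u a < u b) :
    BruhatLE u (u * Equiv.swap a b) :=
  BruhatStep.le ⟨a, b, rfl, by rw [len_mul_simple hab hu]; omega⟩

theorem mul_simple_le (hab : b.val = a.val + 1) {u : S n} (hu : u b < u a) :
    BruhatLE (u * Equiv.swap a b) u :=
  BruhatStep.le ⟨a, b, (mul_simple_mul_simple u).symm, by
    have := len_mul_simple_of_gt hab hu; omega⟩

variable (a b) in
/-- The larger of `u` and `u * s` for the adjacent transposition `s = (a b)`. -/
def up (u : S n) : S n := if u a < u b then u * Equiv.swap a b else u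

variable (a b) in
/-- The smaller of `u` and `u * s` for the adjacent transposition `s = (a b)`. -/
def dn (u : S n) : S n := if u a < u b then u else u * Equiv.swap a b

theorem le_up (hab : b.val = a.val + 1) (u : S n) : BruhatLE u (up a b u) := by
  unfold up; split_ifs with h
  · exact le_mul_simple hab h
  · exact .refl u

theorem up_mul_simple (hab : b.val = a.val + 1) (u : S n) :
    up a b (u * Equiv.swap a b) = up a b u := by
  unfold up
  simp only [mul_simple_apply_lt_iff, ← not_apply_lt_iff hab, mul_simple_mul_simple]
  split_ifs <;> rfl

theorem dn_mul_simple (hab : b.val = a.val + 1) (u : S n) :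
    dn a b (u * Equiv.swap a b) = dn a b u := by
  unfold dn
  simp only [mul_simple_apply_lt_iff, ← not_apply_lt_iff hab, mul_simple_mul_simple]
  split_ifs <;> rfl

theorem up_of_lt {u : S n} (h : u a < u b) : up a b u = u * Equiv.swap a b := if_pos h

theorem up_of_gt {u : S n} (h : u b < u a) : up a b u = u := if_neg (not_lt.2 h.le)

theorem dn_of_lt {u : S n} (h : u a < u b) : dn a b u = u := if_pos h

theorem dn_of_gt {u : S n} (h : u b < u a) : dn a b u = u * Equiv.swap a b :=
  if_neg (not_lt.2 h.le)

/-- A Bruhat step survives right multiplication by `s = (a b)` unless it is multiplication by `s`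
itself. -/
theorem mul_simple_step (hab : b.val = a.val + 1) {u : S n} {i j : Fin n} (hij : i < j)
    (hu : u i < u j) (h : ¬ (i = a ∧ j = b)) :
    BruhatStep (u * Equiv.swap a b) (u * Equiv.swap i j * Equiv.swap a b) := by
  rw [bruhatStep_iff]
  refine ⟨_, _, simple_lt_simple hab hij h, by simpa using hu, ?_⟩
  rw [mul_assoc, mul_assoc, Equiv.swap_mul_eq_mul_swap (Equiv.swap a b) i j, Equiv.swap_inv]

/-- The lifting property of Bruhat order: `u ↦ min(u, us)` and `u ↦ max(u, us)` are monotone. -/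
theorem dn_mono_and_up_mono (hab : b.val = a.val + 1) {u v : S n} (h : BruhatLE u v) :
    BruhatLE (dn a b u) (dn a b v) ∧ BruhatLE (up a b u) (up a b v) := by
  induction h with
  | refl => exact ⟨.refl _, .refl _⟩
  | @tail v w _ hs ih =>
    suffices BruhatLE (dn a b v) (dn a b w) ∧ BruhatLE (up a b v) (up a b w) from
      ⟨ih.1.trans this.1, ih.2.trans this.2⟩
    obtain ⟨i, j, hij, hv, rfl⟩ := bruhatStep_iff.1 hs
    by_cases h : i = a ∧ j = b
    · obtain ⟨rfl, rfl⟩ := h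
      rw [up_mul_simple hab, dn_mul_simple hab]
      exact ⟨.refl _, .refl _⟩
    · have h1 := hs.le
      have h2 := (mul_simple_step hab hij hv h).le
      set w := v * Equiv.swap i j
      by_cases cv : v a < v b <;> by_cases cw : w a < w b
      · rw [dn_of_lt cv, dn_of_lt cw, up_of_lt cv, up_of_lt cw]
        exact ⟨h1, h2⟩
      · have h3 := le_mul_simple hab cv
        rw [not_apply_lt_iff hab] at cw
        have h4 := mul_simple_le hab cw
        rw [dn_of_lt cv, dn_of_gt cw, up_of_lt cv, up_of_gt cw]
        exact ⟨h3.trans h2, h2.trans h4⟩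
      · have h3 := le_mul_simple hab cw
        rw [not_apply_lt_iff hab] at cv
        have h4 := mul_simple_le hab cv
        rw [dn_of_gt cv, dn_of_lt cw, up_of_gt cv, up_of_lt cw]
        exact ⟨h4.trans h1, h1.trans h3⟩
      · rw [not_apply_lt_iff hab] at cv cw
        rw [dn_of_gt cv, dn_of_gt cw, up_of_gt cv, up_of_gt cw]
        exact ⟨h2, h1⟩

theorem dn_mono (hab : b.val = a.val + 1) {u v : S n} (h : BruhatLE u v) :
    BruhatLE (dn a b u) (dn a b v) := (dn_mono_and_up_mono hab h).1

theorem up_mono (hab : b.val = a.val + 1) {u v : S n} (h : BruhatLE u v) :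
    BruhatLE (up a b u) (up a b v) := (dn_mono_and_up_mono hab h).2

end Simple

/-! ### Inversion and multiplication by the longest element -/

theorem BruhatLE.inv {u v : S n} (h : BruhatLE u v) : BruhatLE u⁻¹ v⁻¹ := by
  induction h with
  | refl => exact .refl _
  | tail _ hs ih =>
    refine ih.trans (BruhatStep.le ?_)
    obtain ⟨i, j, hij, hv, rfl⟩ := bruhatStep_iff.1 hs
    refine bruhatStep_iff.2 ⟨_, _, hv, by simpa using hij, ?_⟩
    rw [mul_inv_rev, Equiv.swap_inv, Equiv.swap_mul_eq_mul_swap, inv_inv]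

theorem BruhatLE.rev_mul {u v : S n} (h : BruhatLE u v) :
    BruhatLE (Fin.revPerm * v) (Fin.revPerm * u) := by
  induction h with
  | refl => exact .refl _
  | tail _ hs ih =>
    refine BruhatLE.trans (BruhatStep.le ?_) ih
    obtain ⟨i, j, hij, hv, rfl⟩ := bruhatStep_iff.1 hs
    refine bruhatStep_iff.2 ⟨i, j, hij, by simpa using hv, ?_⟩
    rw [mul_assoc, mul_assoc, Equiv.swap_mul_self, mul_one]

/-! ### Descents and subadditivity of length -/

theorem exists_adjacent_descent {u : S n} {i j : Fin n} (hij : i < j) (h : u j < u i) :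
    ∃ a b : Fin n, b.val = a.val + 1 ∧ i ≤ a ∧ b ≤ j ∧ u b < u a := by
  by_contra hc
  push Not at hc
  have : ∀ d : ℕ, ∀ x : Fin n, x ≤ j → x.val = i.val + d → u i ≤ u x := by
    intro d
    induction d with
    | zero =>
      intro x _ hx
      have : x = i := Fin.ext hx
      rw [this]
    | succ d ih =>
      intro x hxj hx
      have hd : i.val + d < n := by omega
      exact (ih ⟨i.val + d, hd⟩ (le_trans (by rw [Fin.le_def, hx]; simp) hxj) rfl).trans
        (hc _ _ (by rw [hx]; simp; omega) (by rw [Fin.le_def]; simp) hxj)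
  have := this (j.val - i.val) j le_rfl (by rw [Fin.lt_def] at hij; omega)
  exact absurd h (not_lt.2 this)

theorem exists_descent_of_len_pos {u : S n} (h : 0 < len u) :
    ∃ a b : Fin n, b.val = a.val + 1 ∧ u b < u a := by
  obtain ⟨⟨i, j⟩, hp⟩ := card_pos.1 h
  rw [mem_filter] at hp
  obtain ⟨a, b, hab, _, _, h⟩ := exists_adjacent_descent hp.2.1 hp.2.2
  exact ⟨a, b, hab, h⟩

theorem eq_one_of_len_eq_zero {u : S n} (h : len u = 0) : u = 1 := by
  have hmono : StrictMono u := by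
    intro i j hij
    by_contra hc
    have hne : u i ≠ u j := fun e => hij.ne (u.injective e)
    have hlt : u j < u i := lt_of_le_of_ne (not_lt.1 hc) hne.symm
    have : (i, j) ∈ (univ.filter fun p : Fin n × Fin n => p.1 < p.2 ∧ u p.2 < u p.1) := by
      rw [mem_filter]; exact ⟨mem_univ _, hij, hlt⟩
    unfold len at h
    rw [card_eq_zero] at h
    rw [h] at this
    simp at this
  have : (hmono.orderIsoOfSurjective u u.surjective) = OrderIso.refl (Fin n) :=
    Subsingleton.elim _ _
  ext i
  have := congrArg (fun f : Fin n ≃o Fin n => (f i).val) this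
  simpa using this

theorem len_mul_le (u z : S n) : len (u * z) ≤ len u + len z := by
  induction hz : len z generalizing z with
  | zero => rw [eq_one_of_len_eq_zero hz, mul_one]; omega
  | succ m ih =>
    obtain ⟨a, b, hab, h⟩ := exists_descent_of_len_pos (u := z) (by omega)
    have h1 := len_mul_simple_of_gt hab h
    have h2 := ih (z * Equiv.swap a b) (by omega)
    have h3 : len (u * z) ≤ len (u * (z * Equiv.swap a b)) + 1 := by
      rw [← mul_assoc]
      by_cases hc : (u * z) a < (u * z) b
      · have := len_mul_simple hab hc; omega
      · have := len_mul_simple_of_gt hab ((not_apply_lt_iff hab _).1 hc); omega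
    omega

/-! ### Bruhat order is graded and thin -/

/-- Covers of Bruhat order, in terms of length: since Bruhat order is graded, these are the elements
with no element strictly between them. -/
def Cov (u v : S n) : Prop := BruhatLE u v ∧ len v = len u + 1

theorem Cov.ne {u v : S n} (h : Cov u v) : u ≠ v := by
  rintro rfl
  have := h.2
  omega

/-- Bruhat order is graded. The induction replaces `w` by `ws` for a descent `s` of `w`. -/
theorem BruhatLE.exists_cov_right {u w : S n} (h : BruhatLE u w) (hne : u ≠ w) :
    ∃ y, BruhatLE u y ∧ Cov y w := by
  induction hw : len w using Nat.strong_induction_on generalizing u w with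
  | _ m ih =>
    have hlt := h.len_lt hne
    obtain ⟨a, b, hab, hd⟩ := exists_descent_of_len_pos (u := w) (by omega)
    have hl := len_mul_simple_of_gt hab hd
    have hcov : Cov (w * Equiv.swap a b) w := ⟨mul_simple_le hab hd, hl.symm⟩
    have hdn := dn_mono hab h
    rw [dn_of_gt hd] at hdn
    by_cases hu : u a < u b
    · rw [dn_of_lt hu] at hdn
      exact ⟨_, hdn, hcov⟩
    · rw [not_apply_lt_iff hab] at hu
      rw [dn_of_gt hu] at hdn
      obtain ⟨y, hy, hyw⟩ := ih _ (by omega) hdn (fun e => hne (mul_right_cancel e)) rfl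
      have hup := up_mono hab hy
      rw [up_mul_simple hab, up_of_gt hu] at hup
      by_cases c : y a < y b
      · have hup' := up_mono hab hyw.1
        rw [up_mul_simple hab, up_of_gt hd] at hup'
        rw [up_of_lt c] at hup hup'
        refine ⟨_, hup, hup', ?_⟩
        have := len_mul_simple hab c
        have := hyw.2
        omega
      · rw [not_apply_lt_iff hab] at c
        rw [up_of_gt c] at hup
        exact ⟨_, hup.trans hyw.1, hcov⟩

theorem BruhatLE.exists_cov_left {u w : S n} (h : BruhatLE u w) (hne : u ≠ w) :
    ∃ y, Cov u y ∧ BruhatLE y w := by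
  induction hm : len w using Nat.strong_induction_on generalizing w with
  | _ m ih =>
    obtain ⟨y, huy, hyw⟩ := h.exists_cov_right hne
    by_cases e : u = y
    · subst e; exact ⟨w, hyw, .refl w⟩
    · obtain ⟨z, hz, hzy⟩ := ih (len y) (by have := hyw.2; omega) huy e rfl
      exact ⟨z, hz, hzy.trans hyw.1⟩

theorem BruhatCov.cov {u v : S n} (h : BruhatCov u v) : Cov u v := by
  obtain ⟨y, hy, hyv⟩ := h.1.1.exists_cov_left h.1.2
  by_cases e : y = v
  · exact e ▸ hy
  · exact absurd ⟨hyv, e⟩ (h.2 y ⟨hy.1, hy.ne⟩)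

/-- Bruhat order is thin: an interval of rank two has exactly two middle elements. The induction
replaces `[u,w]` by `[us,ws]` for a descent `s` of `w`; if `s` is not a descent of `u`, the middle
elements are `us` and `ws`. -/
theorem exists_two_between {u w : S n} (h : BruhatLE u w) (hl : len w = len u + 2) :
    ∃ y y', y ≠ y' ∧ Cov u y ∧ Cov y w ∧ Cov u y' ∧ Cov y' w ∧
      ∀ z, Cov u z → Cov z w → z = y ∨ z = y' := by
  induction hm : len w using Nat.strong_induction_on generalizing u w with
  | _ m ih =>
    obtain ⟨a, b, hab, hd⟩ := exists_descent_of_len_pos (u := w) (by omega)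
    have hlw := len_mul_simple_of_gt hab hd
    have hcw : Cov (w * Equiv.swap a b) w := ⟨mul_simple_le hab hd, hlw.symm⟩
    have hdn := dn_mono hab h
    rw [dn_of_gt hd] at hdn
    by_cases hu : u a < u b
    · have hup := up_mono hab h
      rw [up_of_gt hd, up_of_lt hu] at hup
      rw [dn_of_lt hu] at hdn
      have hlu := len_mul_simple hab hu
      refine ⟨w * Equiv.swap a b, u * Equiv.swap a b, ?_, ⟨hdn, by omega⟩, hcw,
        ⟨le_mul_simple hab hu, hlu⟩, ⟨hup, by omega⟩, ?_⟩
      · intro e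
        have := mul_right_cancel e
        rw [this] at hl
        omega
      · intro z h1 h2
        by_cases hz : z a < z b
        · have := dn_mono hab h2.1
          rw [dn_of_gt hd, dn_of_lt hz] at this
          have h3 := h1.2
          exact Or.inl (this.eq_of_len_le (by omega))
        · rw [not_apply_lt_iff hab] at hz
          have := up_mono hab h1.1
          rw [up_of_gt hz, up_of_lt hu] at this
          have h3 := h1.2
          exact Or.inr (this.eq_of_len_le (by omega)).symm
    · rw [not_apply_lt_iff hab] at hu
      rw [dn_of_gt hu] at hdn
      have hlu := len_mul_simple_of_gt hab hu
      have hcu : Cov (u * Equiv.swap a b) u := ⟨mul_simple_le hab hu, hlu.symm⟩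
      -- Middle elements of `[us, ws]` correspond to middle elements of `[u, w]` under
      -- multiplication by `s`, except that `u` (if it is one) corresponds to `ws`.
      have lift : ∀ y, Cov (u * Equiv.swap a b) y → Cov y (w * Equiv.swap a b) → y a < y b →
          Cov u (y * Equiv.swap a b) ∧ Cov (y * Equiv.swap a b) w := by
        intro y h1 h2 hy
        have h3 := len_mul_simple hab hy
        have h4 := up_mono hab h1.1
        have h5 := up_mono hab h2.1
        rw [up_mul_simple hab, up_of_gt hu, up_of_lt hy] at h4
        rw [up_mul_simple hab, up_of_gt hd, up_of_lt hy] at h5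
        have := h1.2
        exact ⟨⟨h4, by omega⟩, ⟨h5, by omega⟩⟩
      have flat : ∀ y, Cov (u * Equiv.swap a b) y → Cov y (w * Equiv.swap a b) → y b < y a →
          y = u := by
        intro y h1 h2 hy
        have h4 := up_mono hab h1.1
        rw [up_mul_simple hab, up_of_gt hu, up_of_gt hy] at h4
        have := h1.2
        exact (h4.eq_of_len_le (by omega)).symm
      have down : ∀ z, Cov u z → Cov z w → z b < z a →
          Cov (u * Equiv.swap a b) (z * Equiv.swap a b) ∧
            Cov (z * Equiv.swap a b) (w * Equiv.swap a b) := by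
        intro z h1 h2 hz
        have h3 := len_mul_simple_of_gt hab hz
        have h4 := dn_mono hab h1.1
        have h5 := dn_mono hab h2.1
        rw [dn_of_gt hu, dn_of_gt hz] at h4
        rw [dn_of_gt hd, dn_of_gt hz] at h5
        have := h1.2
        exact ⟨⟨h4, by omega⟩, ⟨h5, by omega⟩⟩
      have top : ∀ z, Cov u z → Cov z w → z a < z b → z = w * Equiv.swap a b := by
        intro z h1 h2 hz
        have h4 := dn_mono hab h2.1
        rw [dn_of_gt hd, dn_of_lt hz] at h4
        have := h1.2
        exact h4.eq_of_len_le (by omega)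
      have hws : (w * Equiv.swap a b) a < (w * Equiv.swap a b) b :=
        (mul_simple_apply_lt_iff w).2 hd
      have hneq : ∀ y : S n, y a < y b → y * Equiv.swap a b ≠ w * Equiv.swap a b := by
        intro y hy e
        have := mul_right_cancel e
        rw [this] at hy
        exact absurd hd (not_lt.2 hy.le)
      have mixed : ∀ y, Cov (u * Equiv.swap a b) y → Cov y (w * Equiv.swap a b) → y a < y b →
          Cov u (w * Equiv.swap a b) → (∀ z, Cov (u * Equiv.swap a b) z →
            Cov z (w * Equiv.swap a b) → z = y ∨ z = u) →
          ∃ y y', y ≠ y' ∧ Cov u y ∧ Cov y w ∧ Cov u y' ∧ Cov y' w ∧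
            ∀ z, Cov u z → Cov z w → z = y ∨ z = y' := by
        intro y c1 c2 hy hcuw hall
        obtain ⟨d1, d2⟩ := lift y c1 c2 hy
        refine ⟨_, _, hneq y hy, d1, d2, hcuw, hcw, ?_⟩
        intro z h1 h2
        by_cases hz : z a < z b
        · exact Or.inr (top z h1 h2 hz)
        · rw [not_apply_lt_iff hab] at hz
          obtain ⟨e1, e2⟩ := down z h1 h2 hz
          rcases hall _ e1 e2 with e | e
          · left; rw [← e, mul_simple_mul_simple]
          · have := (mul_simple_apply_lt_iff (a := a) (b := b) z).2 hz
            rw [e] at this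
            exact absurd hu (not_lt.2 this.le)
      obtain ⟨y, y', hne, c1, c2, c1', c2', hall⟩ := ih _ (by omega) hdn (by omega) rfl
      by_cases hy : y a < y b <;> by_cases hy' : y' a < y' b
      · obtain ⟨d1, d2⟩ := lift y c1 c2 hy
        obtain ⟨d1', d2'⟩ := lift y' c1' c2' hy'
        refine ⟨_, _, fun e => hne (mul_right_cancel e), d1, d2, d1', d2', ?_⟩
        intro z h1 h2
        by_cases hz : z a < z b
        · have e := top z h1 h2 hz
          rw [e] at h1
          have h6 : Cov u (w * Equiv.swap a b) := h1
          rcases hall u hcu h6 with e' | e'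
          · rw [← e'] at hy; exact absurd hu (not_lt.2 hy.le)
          · rw [← e'] at hy'; exact absurd hu (not_lt.2 hy'.le)
        · rw [not_apply_lt_iff hab] at hz
          obtain ⟨e1, e2⟩ := down z h1 h2 hz
          rcases hall _ e1 e2 with e | e
          · left; rw [← e, mul_simple_mul_simple]
          · right; rw [← e, mul_simple_mul_simple]
      · rw [not_apply_lt_iff hab] at hy'
        have e := flat y' c1' c2' hy'
        rw [e] at c2' hall
        exact mixed y c1 c2 hy c2' hall
      · rw [not_apply_lt_iff hab] at hy
        have e := flat y c1 c2 hy
        rw [e] at c2 hall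
        exact mixed y' c1' c2' hy' c2 fun z h1 h2 => (hall z h1 h2).symm
      · rw [not_apply_lt_iff hab] at hy hy'
        exact absurd ((flat y c1 c2 hy).trans (flat y' c1' c2' hy').symm) hne

/-! ### The projection `σ_k` and its monotonicity -/

/-- The sum of the elements of a subset of `Fin n`, as a natural number. It strictly increases along
Bruhat order whenever `σ_k` changes, and thus linearly orders the cosets met by a chain. -/
def gsum (I : Finset (Fin n)) : ℕ := ∑ x ∈ I, x.val

theorem mem_sigma {w : S n} {x : Fin n} : x ∈ sigma k w ↔ (w⁻¹ x).val < k := by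
  unfold sigma
  simp only [mem_image, mem_filter, mem_univ, true_and]
  constructor
  · rintro ⟨i, hi, rfl⟩; simpa using hi
  · intro h; exact ⟨_, h, by simp⟩

theorem apply_mem_sigma {w : S n} {i : Fin n} : w i ∈ sigma k w ↔ i.val < k := by
  rw [mem_sigma]; simp

theorem sigma_mul (u z : S n) : sigma k (u * z) = (sigma k z).image u := by
  unfold sigma
  rw [image_image]; rfl

theorem sigma_mul_of_parabolic {u z : S n} (hz : ∀ i, i.val < k ↔ (z i).val < k) :
    sigma k (u * z) = sigma k u := by
  ext x
  rw [mem_sigma, mem_sigma, mul_inv_rev, Equiv.Perm.mul_apply, hz]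
  simp

theorem sigma_mul_swap {u : S n} {i j : Fin n} (h : i.val < k ↔ j.val < k) :
    sigma k (u * Equiv.swap i j) = sigma k u := by
  apply sigma_mul_of_parabolic
  intro x
  rw [Equiv.swap_apply_def]
  split_ifs with h1 h2
  · rw [h1]; exact h
  · rw [h2]; exact h.symm
  · rfl

theorem sigma_mul_swap_ne {u : S n} {i j : Fin n} (hi : i.val < k) (hj : ¬ j.val < k) :
    u j ∈ sigma k (u * Equiv.swap i j) ∧ u i ∉ sigma k (u * Equiv.swap i j) ∧
      sigma k (u * Equiv.swap i j) = insert (u j) ((sigma k u).erase (u i)) := by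
  have h1 : u j ∈ sigma k (u * Equiv.swap i j) := by rw [mem_sigma]; simpa using hi
  have h2 : u i ∉ sigma k (u * Equiv.swap i j) := by rw [mem_sigma]; simpa using hj
  refine ⟨h1, h2, ?_⟩
  ext x
  rw [mem_insert, mem_erase]
  by_cases e1 : x = u j
  · simp [e1, h1]
  · by_cases e2 : x = u i
    · subst e2; simp [h2, e1]
    · simp only [e1, e2, false_or, ne_eq, not_false_eq_true, true_and]
      rw [mem_sigma, mem_sigma, mul_inv_rev, Equiv.Perm.mul_apply, Equiv.swap_inv,
        Equiv.swap_apply_of_ne_of_ne]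
      · intro e; exact e2 (by rw [← e]; simp)
      · intro e; exact e1 (by rw [← e]; simp)

/-- A Bruhat step either stays in its coset or exchanges an element `x` of `σ_k` for a larger
`y`. -/
theorem BruhatStep.sigma_cases {u v : S n} (h : BruhatStep u v) :
    (∃ i j, i < j ∧ u i < u j ∧ v = u * Equiv.swap i j ∧ (i.val < k ↔ j.val < k) ∧
      sigma k v = sigma k u) ∨
    (∃ x y : Fin n, x < y ∧ x ∈ sigma k u ∧ y ∉ sigma k u ∧ x ∉ sigma k v ∧ y ∈ sigma k v ∧
      gsum (sigma k u) < gsum (sigma k v)) := by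
  obtain ⟨i, j, hij, hu, rfl⟩ := bruhatStep_iff.1 h
  by_cases hi : i.val < k
  · by_cases hj : j.val < k
    · exact Or.inl ⟨i, j, hij, hu, rfl, by tauto, sigma_mul_swap (by tauto)⟩
    · right
      obtain ⟨h1, h2, h3⟩ := sigma_mul_swap_ne (u := u) hi hj
      have hui : u i ∈ sigma k u := apply_mem_sigma.2 hi
      have huj : u j ∉ sigma k u := fun h => hj (apply_mem_sigma.1 h)
      refine ⟨u i, u j, hu, hui, huj, h2, h1, ?_⟩
      rw [h3]
      unfold gsum
      rw [sum_insert (fun h => huj (mem_of_mem_erase h))]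
      have := add_sum_erase (sigma k u) (fun x => x.val) hui
      rw [← this]
      have : (u i).val < (u j).val := hu
      omega
  · have hj : ¬ j.val < k := by have : i.val < j.val := hij; omega
    exact Or.inl ⟨i, j, hij, hu, rfl, by tauto, sigma_mul_swap (by tauto)⟩

theorem BruhatLE.sigma_eq_or_gsum_lt {u v : S n} (h : BruhatLE u v) :
    sigma k u = sigma k v ∨ gsum (sigma k u) < gsum (sigma k v) := by
  induction h with
  | refl => exact Or.inl rfl
  | tail _ hs ih =>
    rcases hs.sigma_cases (k := k) with ⟨_, _, _, _, _, _, h⟩ | ⟨_, _, _, _, _, _, _, h⟩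
    · rwa [h]
    · right
      rcases ih with e | e
      · rwa [e]
      · exact e.trans h

theorem BruhatLE.gsum_le {u v : S n} (h : BruhatLE u v) :
    gsum (sigma k u) ≤ gsum (sigma k v) := by
  rcases h.sigma_eq_or_gsum_lt (k := k) with h | h
  · rw [h]
  · exact h.le

theorem BruhatLE.sigma_eq_of_gsum_le {u v : S n} (h : BruhatLE u v)
    (hg : gsum (sigma k v) ≤ gsum (sigma k u)) : sigma k u = sigma k v :=
  h.sigma_eq_or_gsum_lt.resolve_right (not_lt.2 hg)

/-! ### Minimal elements of a coset above a permutation -/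

/-- The parabolic subgroup itself, the coset with `σ_k` a lower set, is a lower set of Bruhat
order. -/
theorem sigma_eq_of_le_of_lower {u v : S n} (h : BruhatLE u v)
    (hI : ∀ x y : Fin n, x < y → y ∈ sigma k v → x ∈ sigma k v) : sigma k u = sigma k v := by
  induction h using Relation.ReflTransGen.head_induction_on with
  | refl => rfl
  | head hs _ ih =>
    rcases hs.sigma_cases (k := k) with ⟨_, _, _, _, _, _, h⟩ | ⟨x, y, hxy, _, _, hx, hy, _⟩
    · rw [← ih, h]
    · rw [ih] at hx hy
      exact absurd (hI x y hxy hy) hx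

theorem exists_adjacent_of_not_lower {I : Finset (Fin n)} {x y : Fin n} (hxy : x < y) (hy : y ∈ I)
    (hx : x ∉ I) : ∃ a b : Fin n, b.val = a.val + 1 ∧ a ∉ I ∧ b ∈ I := by
  by_contra hc
  push Not at hc
  have : ∀ d : ℕ, ∀ z : Fin n, z.val = x.val + d → z ∉ I := by
    intro d
    induction d with
    | zero =>
      intro z hz
      have : z = x := Fin.ext hz
      rwa [this]
    | succ d ih =>
      intro z hz
      have hd : x.val + d < n := by omega
      exact hc ⟨x.val + d, hd⟩ z (by rw [hz]; simp; omega) (ih _ rfl)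
  exact this (y.val - x.val) y (by rw [Fin.lt_def] at hxy; omega) hy

/-- Deodhar's lemma: a coset of `S_k × S_{n-k}` that meets the upper set of `u` meets it in a set
with a least element. The coset is moved down by left multiplication with adjacent
transpositions, to the parabolic subgroup itself. -/
theorem exists_least_in_coset (I : Finset (Fin n)) (u : S n)
    (h : ∃ v, sigma k v = I ∧ BruhatLE u v) :
    ∃ m, sigma k m = I ∧ BruhatLE u m ∧ ∀ v, sigma k v = I → BruhatLE u v → BruhatLE m v := by
  induction hg : gsum I using Nat.strong_induction_on generalizing I u with
  | _ g ih =>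
    by_cases hI : ∀ x y : Fin n, x < y → y ∈ I → x ∈ I
    · obtain ⟨v, hv, huv⟩ := h
      refine ⟨u, ?_, .refl u, fun _ _ h => h⟩
      rw [← hv] at hI ⊢
      exact sigma_eq_of_le_of_lower huv hI
    · push Not at hI
      obtain ⟨x, y, hxy, hy, hx⟩ := hI
      obtain ⟨a, b, hab, ha, hb⟩ := exists_adjacent_of_not_lower hxy hy hx
      -- left multiplication by `s` is right multiplication by `s` on inverses
      have hsig : ∀ v : S n,
          sigma k (v⁻¹ * Equiv.swap a b)⁻¹ = (sigma k v).image (Equiv.swap a b) := by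
        intro v
        rw [mul_inv_rev, inv_inv, Equiv.swap_inv, sigma_mul]
      have hdesc : ∀ v : S n, sigma k v = I → v⁻¹ b < v⁻¹ a := by
        intro v hv
        rw [← hv, mem_sigma] at ha hb
        rw [Fin.lt_def]; omega
      have hasc : ∀ v : S n, sigma k v = I.image (Equiv.swap a b) → v⁻¹ a < v⁻¹ b := by
        intro v hv
        have h1 : a ∈ sigma k v := by
          rw [hv]; exact mem_image.2 ⟨b, hb, Equiv.swap_apply_right a b⟩
        have h2 : b ∉ sigma k v := by
          rw [hv]; intro h
          obtain ⟨c, hc, e⟩ := mem_image.1 h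
          have : c = a := by rw [← Equiv.swap_apply_self a b c, e, Equiv.swap_apply_right]
          exact ha (this ▸ hc)
        rw [mem_sigma] at h1 h2
        rw [Fin.lt_def]; omega
      have hdown : ∀ v : S n, sigma k v = I → BruhatLE u v →
          BruhatLE (dn a b u⁻¹)⁻¹ (v⁻¹ * Equiv.swap a b)⁻¹ := by
        intro v hv huv
        have := (dn_mono hab huv.inv).inv
        rwa [dn_of_gt (hdesc v hv)] at this
      have hlt : gsum (I.image (Equiv.swap a b)) < g := by
        rw [← hg]
        unfold gsum
        rw [sum_image (fun _ _ _ _ h => (Equiv.swap a b).injective h)]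
        apply sum_lt_sum
        · intro i hi
          by_cases e : i = b
          · rw [e, Equiv.swap_apply_right]; omega
          · rw [Equiv.swap_apply_of_ne_of_ne (by rintro rfl; exact ha hi) e]
        · exact ⟨b, hb, by rw [Equiv.swap_apply_right]; omega⟩
      obtain ⟨v, hv, huv⟩ := h
      obtain ⟨m, hm, hum, hmin⟩ := ih _ hlt (I.image (Equiv.swap a b)) (dn a b u⁻¹)⁻¹
        ⟨_, by rw [hsig, hv], hdown v hv huv⟩ rfl
      refine ⟨(m⁻¹ * Equiv.swap a b)⁻¹, ?_, ?_, ?_⟩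
      · rw [hsig, hm, image_image]
        have : (Equiv.swap a b : Fin n → Fin n) ∘ (Equiv.swap a b) = id := by
          ext c; simp
        rw [this, image_id]
      · have h1 := up_mono hab hum.inv
        rw [inv_inv, up_of_lt (hasc m hm)] at h1
        have h2 : BruhatLE u⁻¹ (up a b (dn a b u⁻¹)) := by
          unfold dn
          split_ifs with c
          · exact le_up hab _
          · rw [up_mul_simple hab]; exact le_up hab _
        have := (h2.trans h1).inv
        rwa [inv_inv] at this
      · intro v hv huv
        have h1 := up_mono hab (hmin _ (by rw [hsig, hv]) (hdown v hv huv)).inv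
        rw [up_of_lt (hasc m hm), inv_inv, up_mul_simple hab, up_of_gt (hdesc v hv)] at h1
        have := h1.inv
        rwa [inv_inv] at this

/-- Above `x`, a cover `y` of `x` in another coset is least in its coset. -/
theorem Cov.le_of_sigma_eq {x y y' : S n} (h : Cov x y) (hne : sigma k x ≠ sigma k y)
    (h' : BruhatLE x y') (e : sigma k y' = sigma k y) : BruhatLE y y' := by
  obtain ⟨m, hm, hxm, hmin⟩ := exists_least_in_coset (sigma k y) x ⟨y, rfl, h.1⟩
  have h1 := hmin y rfl h.1
  have h2 := hxm.len_lt (by rintro rfl; exact hne hm)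
  have h3 := h.2
  rw [← h1.eq_of_len_le (by omega)]
  exact hmin y' e h'

theorem revPerm_mul_revPerm_mul (v : S n) : Fin.revPerm * (Fin.revPerm * v) = v := by
  ext i; simp

/-- The dual of `exists_least_in_coset`, obtained by left multiplication with the longest
element. -/
theorem exists_greatest_in_coset (I : Finset (Fin n)) (w : S n)
    (h : ∃ v, sigma k v = I ∧ BruhatLE v w) :
    ∃ m, sigma k m = I ∧ BruhatLE m w ∧ ∀ v, sigma k v = I → BruhatLE v w → BruhatLE v m := by
  obtain ⟨v, hv, hvw⟩ := h
  obtain ⟨m, hm, hwm, hmin⟩ := exists_least_in_coset (k := k) (I.image Fin.revPerm)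
    (Fin.revPerm * w) ⟨Fin.revPerm * v, by rw [sigma_mul, hv], hvw.rev_mul⟩
  refine ⟨Fin.revPerm * m, ?_, ?_, ?_⟩
  · rw [sigma_mul, hm, image_image]
    have : (Fin.revPerm : Fin n → Fin n) ∘ Fin.revPerm = id := by
      ext c; simp
    rw [this, image_id]
  · have := hwm.rev_mul
    rwa [revPerm_mul_revPerm_mul] at this
  · intro v hv hvw
    have := (hmin (Fin.revPerm * v) (by rw [sigma_mul, hv]) hvw.rev_mul).rev_mul
    rwa [revPerm_mul_revPerm_mul] at this

/-- Below `y`, an element `x` covered by `y` in another coset is greatest in its coset. -/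
theorem Cov.ge_of_sigma_eq {x y x' : S n} (h : Cov x y) (hne : sigma k x ≠ sigma k y)
    (h' : BruhatLE x' y) (e : sigma k x' = sigma k x) : BruhatLE x' x := by
  obtain ⟨m, hm, hmy, hmax⟩ := exists_greatest_in_coset (sigma k x) y ⟨x, rfl, h.1⟩
  have h1 := hmax x rfl h.1
  have h2 := hmy.len_lt (by rintro rfl; exact hne hm.symm)
  have h3 := h.2
  rw [h1.eq_of_len_le (by omega)]
  exact hmax x' e h'

/-- A cover of `x` in another coset is determined by its coset. -/
theorem Cov.eq_of_sigma_eq {x y y' : S n} (h : Cov x y) (hne : sigma k x ≠ sigma k y)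
    (h' : Cov x y') (e : sigma k y' = sigma k y) : y = y' :=
  (h.le_of_sigma_eq hne h'.1 e).eq_of_len_le (by rw [h.2, h'.2])

/-- An element covered by `y` in another coset is determined by its coset. -/
theorem Cov.eq_of_sigma_eq' {x x' y : S n} (h : Cov x y) (hne : sigma k x ≠ sigma k y)
    (h' : Cov x' y) (e : sigma k x' = sigma k x) : x = x' :=
  ((h.ge_of_sigma_eq hne h'.1 e).eq_of_len_le (by have := h.2; have := h'.2; omega)).symm

/-! ### Faces of the projected order complex -/

theorem Cov.exists_other {u x w : S n} (h : Cov u x) (h' : Cov x w) :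
    ∃ y, y ≠ x ∧ Cov u y ∧ Cov y w := by
  obtain ⟨y, y', hne, h1, h2, h1', h2', hall⟩ :=
    exists_two_between (h.1.trans h'.1) (by rw [h'.2, h.2])
  by_cases e : y = x
  · exact ⟨y', fun e' => hne (e.trans e'.symm), h1', h2'⟩
  · exact ⟨y, e, h1, h2⟩

theorem mem_sigmaComplex {u w : S n} {F : Finset (Finset (Fin n))} :
    F ∈ sigmaComplex k u w ↔ ∃ C : Finset (S n), (∀ v ∈ C, BruhatLE u v ∧ BruhatLE v w) ∧
      (∀ v ∈ C, ∀ v' ∈ C, v ≠ v' → BruhatLE v v' ∨ BruhatLE v' v) ∧ C.image (sigma k) = F := by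
  constructor
  · rintro ⟨C, ⟨h1, h2⟩, rfl⟩
    exact ⟨C, fun v hv => h1 hv, fun v hv v' hv' hne => h2 hv hv' hne, rfl⟩
  · rintro ⟨C, h1, h2, rfl⟩
    exact ⟨C, ⟨fun v hv => h1 v hv, fun v hv v' hv' hne => h2 v hv v' hv' hne⟩, rfl⟩

theorem sigmaComplex_mono {u u' w w' : S n} (hu : BruhatLE u u') (hw : BruhatLE w' w) :
    sigmaComplex k u' w' ⊆ sigmaComplex k u w := by
  intro F hF
  rw [mem_sigmaComplex] at hF ⊢
  obtain ⟨C, h1, h2, h3⟩ := hF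
  exact ⟨C, fun v hv => ⟨hu.trans (h1 v hv).1, (h1 v hv).2.trans hw⟩, h2, h3⟩

theorem insert_mem_sigmaComplex {u x w : S n} {F : Finset (Finset (Fin n))}
    (hF : F ∈ sigmaComplex k x w) (hu : BruhatLE u x) (hx : BruhatLE x w) :
    insert (sigma k u) F ∈ sigmaComplex k u w := by
  classical
  rw [mem_sigmaComplex] at hF ⊢
  obtain ⟨C, h1, h2, rfl⟩ := hF
  refine ⟨insert u C, ?_, ?_, image_insert _ _ _⟩
  · intro v hv
    rcases mem_insert.1 hv with rfl | hv
    · exact ⟨.refl _, hu.trans hx⟩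
    · exact ⟨hu.trans (h1 v hv).1, (h1 v hv).2⟩
  · intro v hv v' hv' hne
    rcases mem_insert.1 hv with e | hvC <;> rcases mem_insert.1 hv' with e' | hvC'
    · exact absurd (e.trans e'.symm) hne
    · exact Or.inl (e ▸ hu.trans (h1 v' hvC').1)
    · exact Or.inr (e' ▸ hu.trans (h1 v hvC).1)
    · exact h2 v hvC v' hvC' hne

/-- Splitting off the bottom of a chain that has been refined to a saturated one at `u`. -/
theorem exists_cov_subset_insert {u w : S n} {F : Finset (Finset (Fin n))}
    (hF : F ∈ sigmaComplex k u w) (hu : BruhatLE u w) (hne : u ≠ w) :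
    ∃ x, Cov u x ∧ BruhatLE x w ∧ ∃ F' ∈ sigmaComplex k x w, sigma k x ∈ F' ∧
      F ⊆ insert (sigma k u) F' := by
  classical
  obtain ⟨C, h1, h2, rfl⟩ := mem_sigmaComplex.1 hF
  -- `w` is added to the chain, so that there is a least element above `u`
  obtain ⟨c, hc, hmin⟩ := exists_min_image ((insert w C).erase u) len
    ⟨w, mem_erase.2 ⟨hne.symm, mem_insert_self _ _⟩⟩
  obtain ⟨hcu, hc⟩ := mem_erase.1 hc
  have huc : BruhatLE u c ∧ BruhatLE c w := by
    rcases mem_insert.1 hc with rfl | hc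
    · exact ⟨hu, .refl _⟩
    · exact h1 c hc
  have hle : ∀ v ∈ C, v ≠ u → BruhatLE c v := by
    intro v hv hvu
    have hl := hmin v (mem_erase.2 ⟨hvu, mem_insert_of_mem hv⟩)
    by_cases e : c = v
    · rw [e]; exact .refl _
    rcases mem_insert.1 hc with rfl | hc
    · rw [(h1 v hv).2.eq_of_len_le hl]; exact .refl _
    · rcases h2 c hc v hv e with h | h
      · exact h
      · exact absurd (h.eq_of_len_le hl).symm e
  obtain ⟨x, hux, hxc⟩ := huc.1.exists_cov_left hcu.symm
  have hxw := hxc.trans huc.2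
  refine ⟨x, hux, hxw, insert (sigma k x) ((C.erase u).image (sigma k)), ?_,
    mem_insert_self _ _, ?_⟩
  · refine insert_mem_sigmaComplex (x := x) (mem_sigmaComplex.2 ⟨C.erase u, ?_, ?_, rfl⟩) (.refl _)
      hxw
    · intro v hv
      obtain ⟨h3, h4⟩ := mem_erase.1 hv
      exact ⟨hxc.trans (hle v h4 h3), (h1 v h4).2⟩
    · intro v hv v' hv' hne
      exact h2 v (mem_of_mem_erase hv) v' (mem_of_mem_erase hv') hne
  · intro I hI
    obtain ⟨v, hv, rfl⟩ := mem_image.1 hI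
    by_cases e : v = u
    · rw [e]; exact mem_insert_self _ _
    · exact mem_insert_of_mem (mem_insert_of_mem (mem_image_of_mem _ (mem_erase.2 ⟨e, hv⟩)))

theorem card_add_len_le {u w : S n} {F : Finset (Finset (Fin n))} (hF : F ∈ sigmaComplex k u w)
    (hu : BruhatLE u w) : F.card + len u ≤ len w + 1 := by
  classical
  obtain ⟨C, h1, h2, rfl⟩ := mem_sigmaComplex.1 hF
  have h3 : (C.image (sigma k)).card ≤ C.card := card_image_le
  have h4 : C.card ≤ (Icc (len u) (len w)).card := by
    apply card_le_card_of_injOn len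
    · intro v hv
      exact mem_coe.2 (mem_Icc.2 ⟨(h1 v hv).1.len_le, (h1 v hv).2.len_le⟩)
    · intro v hv v' hv' e
      by_contra hne
      rcases h2 v hv v' hv' hne with h | h
      · exact hne (h.eq_of_len_le e.ge)
      · exact hne (h.eq_of_len_le e.le).symm
  rw [Nat.card_Icc] at h4
  have := hu.len_le
  omega

theorem sigma_notMem_of_le {u x w : S n} {F : Finset (Finset (Fin n))}
    (hF : F ∈ sigmaComplex k x w) (hu : BruhatLE u x) (hne : sigma k u ≠ sigma k x) :
    sigma k u ∉ F := by
  obtain ⟨C, h1, h2, rfl⟩ := mem_sigmaComplex.1 hF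
  intro h
  obtain ⟨v, hv, e⟩ := mem_image.1 h
  have h3 := (h1 v hv).1.gsum_le (k := k)
  rw [e] at h3
  exact hne (hu.sigma_eq_of_gsum_le h3)

variable (k) in
/-- `w` is the least element of its coset (a Grassmannian permutation): no other element of the
coset lies below it. -/
def IsGrass (w : S n) : Prop := ∀ y, BruhatLE y w → sigma k y = sigma k w → y = w

/-- For Grassmannian `w`, every `σ_k(Δ([u,w]))` is pure of dimension `ℓ(w) - ℓ(u)`. -/
theorem IsGrass.exists_facet {w : S n} (hw : IsGrass k w) {u : S n} (hu : BruhatLE u w)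
    {F : Finset (Finset (Fin n))} (hF : F ∈ sigmaComplex k u w) :
    ∃ G ∈ sigmaComplex k u w, F ⊆ G ∧ G.card + len u = len w + 1 := by
  induction hm : len w - len u using Nat.strong_induction_on generalizing u F with
  | _ m ih =>
    have cons : ∀ {x : S n} {G : Finset (Finset (Fin n))}, Cov u x → BruhatLE x w →
        sigma k u ≠ sigma k x → G ∈ sigmaComplex k x w → G.card + len x = len w + 1 →
        insert (sigma k u) G ∈ sigmaComplex k u w ∧
          (insert (sigma k u) G).card + len u = len w + 1 := by
      intro x G hux hxw hne hG hc
      refine ⟨insert_mem_sigmaComplex hG hux.1 hxw, ?_⟩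
      rw [card_insert_of_notMem (sigma_notMem_of_le hG hux.1 hne)]
      have := hux.2
      omega
    by_cases huw : u = w
    · subst huw
      refine ⟨insert (sigma k u) F, insert_mem_sigmaComplex hF (.refl _) (.refl _),
        subset_insert _ _, ?_⟩
      have h1 := card_add_len_le (insert_mem_sigmaComplex hF (.refl u) (.refl _)) (.refl _)
      have h2 : 0 < (insert (sigma k u) F).card := card_pos.2 ⟨_, mem_insert_self _ _⟩
      omega
    · obtain ⟨x, hux, hxw, F', hF', hxF', hFF'⟩ := exists_cov_subset_insert hF hu huw
      have hl := hxw.len_le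
      have hl' := hux.2
      obtain ⟨G, hG, hFG, hcard⟩ := ih _ (by omega) hxw hF' rfl
      by_cases hs : sigma k u = sigma k x
      · -- the first step stays in the coset: exchange it with the next one
        by_cases hxw' : x = w
        · exact absurd (hw u hu (by rw [hs, hxw'])) huw
        obtain ⟨x', hxx', hxw', G', hG', hxG', hGG'⟩ := exists_cov_subset_insert hG hxw hxw'
        have h1 := card_add_len_le hG' hxw'
        have hs' : sigma k x ≠ sigma k x' := by
          intro e
          rw [e, insert_eq_of_mem hxG'] at hGG'
          have := card_le_card hGG'
          have := hxx'.2
          omega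
        obtain ⟨y, hyx, huy, hyx'⟩ := hux.exists_other hxx'
        have hy : sigma k u ≠ sigma k y := by
          intro e
          exact hyx (hxx'.eq_of_sigma_eq' hs' hyx' (by rw [← e, hs])).symm
        have hyw := hyx'.1.trans hxw'
        have := hyw.len_le
        have := huy.2
        obtain ⟨H, hH, hGH, hcardH⟩ := ih _ (by omega) hyw
          (insert_mem_sigmaComplex hG' hyx'.1 hxw') rfl
        obtain ⟨h2, h3⟩ := cons huy hyw hy hH hcardH
        refine ⟨_, h2, ?_, h3⟩
        intro I hI
        rcases mem_insert.1 (hFF' hI) with rfl | hI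
        · exact mem_insert_self _ _
        · rcases mem_insert.1 (hGG' (hFG hI)) with rfl | hI
          · rw [hs]; exact mem_insert_self _ _
          · exact mem_insert_of_mem (hGH (mem_insert_of_mem hI))
      · obtain ⟨h2, h3⟩ := cons hux hxw hs hG hcard
        exact ⟨_, h2, hFF'.trans (insert_subset_insert _ hFG), h3⟩

/-- A maximal face of `σ_k(Δ([u,v]))` has full dimension, unless it avoids `u`: a step inside a
coset can be moved down a chain until it starts at `u`, because an exchange that produces a new
coset would enlarge the face. -/
theorem card_eq_or_mem_of_maximal {u v : S n} (hu : BruhatLE u v) {F : Finset (Finset (Fin n))}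
    (hF : F ∈ sigmaComplex k u v) (hmax : ∀ G ∈ sigmaComplex k u v, F ⊆ G → F = G) :
    F.card + len u = len v + 1 ∨
      ∃ x, Cov u x ∧ BruhatLE x v ∧ sigma k u = sigma k x ∧ F ∈ sigmaComplex k x v := by
  induction hm : len v - len u using Nat.strong_induction_on generalizing u F with
  | _ m ih =>
    by_cases huv : u = v
    · subst huv
      left
      have h0 := hmax _ (insert_mem_sigmaComplex hF (.refl _) (.refl _)) (subset_insert _ _)
      have h1 := card_add_len_le hF (.refl _)
      have h2 : 0 < F.card := card_pos.2 ⟨sigma k u, by rw [h0]; exact mem_insert_self _ _⟩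
      omega
    · obtain ⟨x, hux, hxv, F', hF', hxF', hFF'⟩ := exists_cov_subset_insert hF hu huv
      obtain rfl := hmax _ (insert_mem_sigmaComplex hF' hux.1 hxv) hFF'
      by_cases hs : sigma k u = sigma k x
      · right
        refine ⟨x, hux, hxv, hs, ?_⟩
        rwa [hs, insert_eq_of_mem hxF']
      · have huF' := sigma_notMem_of_le hF' hux.1 hs
        have hmax' : ∀ G ∈ sigmaComplex k x v, F' ⊆ G → F' = G := by
          intro G hG hFG
          have huG := sigma_notMem_of_le hG hux.1 hs
          have := hmax _ (insert_mem_sigmaComplex hG hux.1 hxv) (insert_subset_insert _ hFG)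
          rw [← erase_insert huF', this, erase_insert huG]
        have := hxv.len_le
        have := hux.2
        rcases ih _ (by omega) hxv hF' hmax' rfl with h | ⟨x', hxx', hxv', hs', hF''⟩
        · left
          rw [card_insert_of_notMem huF']
          omega
        · right
          obtain ⟨y, hyx, huy, hyx'⟩ := hux.exists_other hxx'
          have hyv := hyx'.1.trans hxv'
          by_cases hy : sigma k u = sigma k y
          · refine ⟨y, huy, hyv, hy, ?_⟩
            rw [hy]
            exact insert_mem_sigmaComplex hF'' hyx'.1 hxv'
          · exfalso
            have hy' : sigma k y ≠ sigma k x' := by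
              intro e
              exact hyx (hux.eq_of_sigma_eq hs huy (by rw [e, hs'])).symm
            have h1 := hmax _ (insert_mem_sigmaComplex
              (insert_mem_sigmaComplex hF'' hyx'.1 hxv') huy.1 hyv)
              (insert_subset_insert _ (subset_insert _ _))
            have h2 : sigma k y ∈ insert (sigma k u) F' := by
              rw [h1]; exact mem_insert_of_mem (mem_insert_self _ _)
            rcases mem_insert.1 h2 with e | h2
            · exact hy e.symm
            · exact sigma_notMem_of_le hF'' hyx'.1 hy' h2

/-! ### Chains over a ridge -/

/-- The sequence `I 0, …, I (l-1)` is strictly increasing for the statistic `gsum`. -/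
def GsumStrict (l : ℕ) (I : ℕ → Finset (Fin n)) : Prop :=
  ∀ i i', i < i' → i' < l → gsum (I i) < gsum (I i')

theorem GsumStrict.injOn {l : ℕ} {I : ℕ → Finset (Fin n)} (hI : GsumStrict l I) {i i' : ℕ}
    (hi : i < l) (hi' : i' < l) (h : gsum (I i) = gsum (I i')) : i = i' := by
  rcases lt_trichotomy i i' with c | c | c
  · have := hI i i' c hi'; omega
  · exact c
  · have := hI i' i c hi; omega

theorem GsumStrict.card_filter {l : ℕ} {I : ℕ → Finset (Fin n)} (hI : GsumStrict l I) {i : ℕ}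
    (hi : i < l) : (((range l).image I).filter fun K => gsum K < gsum (I i)).card = i := by
  have : ((range l).image I).filter (fun K => gsum K < gsum (I i)) = (range i).image I := by
    ext K
    simp only [mem_filter, mem_image, mem_range]
    constructor
    · rintro ⟨⟨j, hj, rfl⟩, h⟩
      refine ⟨j, ?_, rfl⟩
      by_contra hc
      rcases (not_lt.1 hc).eq_or_lt with e | e
      · rw [e] at h; omega
      · have := hI i j e hj; omega
    · rintro ⟨j, hj, rfl⟩
      exact ⟨⟨j, hj.trans hi, rfl⟩, hI j i hj hi⟩
  rw [this, card_image_of_injOn, card_range]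
  intro a ha b hb e
  rw [mem_coe, mem_range] at ha hb
  exact hI.injOn (ha.trans hi) (hb.trans hi) (by rw [e])

/-- A strictly increasing enumeration is determined by the set that it enumerates. -/
theorem GsumStrict.eq_of_image_eq {l : ℕ} {I I' : ℕ → Finset (Fin n)} (hI : GsumStrict l I)
    (hI' : GsumStrict l I') (h : (range l).image I = (range l).image I') {i : ℕ} (hi : i < l) :
    I i = I' i := by
  have : I i ∈ (range l).image I' := by
    rw [← h]; exact mem_image_of_mem _ (mem_range.2 hi)
  obtain ⟨j, hj, e⟩ := mem_image.1 this
  rw [mem_range] at hj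
  have h1 := hI.card_filter hi
  have h2 := hI'.card_filter hj
  rw [h, ← e, h2] at h1
  rw [← e, h1]

variable (k) in
/-- `v 0 < … < v (l-1)` is a chain of `[u,w]` that meets the cosets `I 0, …, I (l-1)` in this
order and has elements of all lengths `ℓ(u), ℓ(u) + 1, …` except `ℓ(u) + j`. When
`ℓ(w) = ℓ(u) + l`, these are the chains of `[u,w]` that project bijectively to the ridge
`{I 0, …, I (l-1)}`. Only the values `v i` with `i < l` matter. -/
structure Lift (u w : S n) (I : ℕ → Finset (Fin n)) (l j : ℕ) (v : ℕ → S n) : Prop where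
  le_l : j ≤ l
  sig : ∀ i < l, sigma k (v i) = I i
  len_lo : ∀ i < j, len (v i) = len u + i
  len_hi : ∀ i, j ≤ i → i < l → len (v i) = len u + i + 1
  step : ∀ i, i + 1 < l → BruhatLE (v i) (v (i + 1))
  ge : ∀ i < l, BruhatLE u (v i)
  le : ∀ i < l, BruhatLE (v i) w

/-- `y` has the missing length `ℓ(u) + j` and fills the gap of the chain `v` of `[u,w]`, giving a
saturated chain. -/
structure Mid (u w : S n) (l j : ℕ) (v : ℕ → S n) (y : S n) : Prop where
  len_eq : len y = len u + j
  ge : BruhatLE u y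
  le : BruhatLE y w
  above : ∀ i < j, BruhatLE (v i) y
  below : ∀ i, j ≤ i → i < l → BruhatLE y (v i)

section

variable {u w : S n} {I : ℕ → Finset (Fin n)} {l j j' : ℕ} {v v' : ℕ → S n} {y y' : S n}

theorem Lift.mono (h : Lift k u w I l j v) {i i' : ℕ} (hi : i ≤ i') (hi' : i' < l) :
    BruhatLE (v i) (v i') := by
  induction hi with
  | refl => exact .refl _
  | step _ ih => exact (ih (by omega)).trans (h.step _ hi')

theorem sigma_ne (hI : GsumStrict l I) (h : Lift k u w I l j v) (h' : Lift k u w I l j' v')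
    {i i' : ℕ} (hi : i < l) (hi' : i' < l) (hne : i ≠ i') :
    sigma k (v i) ≠ sigma k (v' i') := by
  rw [h.sig i hi, h'.sig i' hi']
  intro e
  exact hne (hI.injOn hi hi' (by rw [e]))

/-- Below their gaps, two chains over the same ridge agree: starting from `u`, each element is the
cover of the one before in a prescribed coset. -/
theorem Lift.eq_lo (hI : GsumStrict l I) (h : Lift k u w I l j v) (h' : Lift k u w I l j' v')
    {i : ℕ} (hi : i < j) (hi' : i < j') : v i = v' i := by
  have := h.le_l
  have := h'.le_l
  induction i with
  | zero =>
    rw [← (h.ge 0 (by omega)).eq_of_len_le (by rw [h.len_lo 0 hi]; rfl),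
      ← (h'.ge 0 (by omega)).eq_of_len_le (by rw [h'.len_lo 0 hi']; rfl)]
  | succ i ih =>
    have e := ih (by omega) (by omega)
    have c : Cov (v i) (v (i + 1)) :=
      ⟨h.step i (by omega), by rw [h.len_lo _ hi, h.len_lo i (by omega)]; rfl⟩
    have c' : Cov (v i) (v' (i + 1)) := by
      rw [e]
      exact ⟨h'.step i (by omega), by rw [h'.len_lo _ hi', h'.len_lo i (by omega)]; rfl⟩
    exact c.eq_of_sigma_eq (k := k) (sigma_ne hI h h (by omega) (by omega) (by omega)) c'
      (by rw [h.sig _ (by omega), h'.sig _ (by omega)])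

/-- Above their gaps, two chains over the same ridge agree. -/
theorem Lift.eq_hi (hI : GsumStrict l I) (hl : len w = len u + l) (h : Lift k u w I l j v)
    (h' : Lift k u w I l j' v') {i : ℕ} (hi : j ≤ i) (hi' : j' ≤ i) (hil : i < l) :
    v i = v' i := by
  induction hd : l - 1 - i generalizing i with
  | zero =>
    rw [(h.le i hil).eq_of_len_le (by rw [h.len_hi i hi hil]; omega),
      (h'.le i hil).eq_of_len_le (by rw [h'.len_hi i hi' hil]; omega)]
  | succ d ih =>
    have e := ih (i := i + 1) (by omega) (by omega) (by omega) (by omega)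
    have c : Cov (v i) (v (i + 1)) :=
      ⟨h.step i (by omega), by rw [h.len_hi _ hi hil, h.len_hi (i + 1) (by omega) (by omega)]; rfl⟩
    have c' : Cov (v' i) (v (i + 1)) := by
      rw [e]
      exact ⟨h'.step i (by omega), by
        rw [h'.len_hi _ hi' hil, h'.len_hi (i + 1) (by omega) (by omega)]; rfl⟩
    exact c.eq_of_sigma_eq' (k := k) (sigma_ne hI h h (by omega) (by omega) (by omega)) c'
      (by rw [h.sig _ (by omega), h'.sig _ (by omega)])

theorem Lift.eq (hI : GsumStrict l I) (hl : len w = len u + l) (h : Lift k u w I l j v)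
    (h' : Lift k u w I l j v') {i : ℕ} (hi : i < l) : v i = v' i := by
  by_cases c : i < j
  · exact h.eq_lo hI h' c c
  · exact h.eq_hi hI hl h' (not_lt.1 c) (not_lt.1 c) hi

theorem Mid.congr (h : Mid u w l j v y) (hj : j ≤ l) (e : ∀ i < l, v i = v' i) :
    Mid u w l j v' y :=
  ⟨h.len_eq, h.ge, h.le, fun i hi => e i (by omega) ▸ h.above i hi,
    fun i hi hil => e i hil ▸ h.below i hi hil⟩

/-- Replacing the element of `v` just above the gap by one that fills the gap. -/
theorem Lift.succ (h : Lift k u w I l j v) (hy : Mid u w l j v y) (hj : j < l)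
    (hs : sigma k y = I j) : Lift k u w I l (j + 1) (Function.update v j y) := by
  have hv : ∀ i, i ≠ j → Function.update v j y i = v i := fun i hi => Function.update_of_ne hi _ _
  have hvj : Function.update v j y j = y := Function.update_self _ _ _
  refine ⟨hj, ?_, ?_, ?_, ?_, ?_, ?_⟩
  · intro i hi
    by_cases c : i = j
    · subst c; rw [hvj, hs]
    · rw [hv i c, h.sig i hi]
  · intro i hi
    by_cases c : i = j
    · subst c; rw [hvj, hy.len_eq]
    · rw [hv i c, h.len_lo i (by omega)]
  · intro i hi hil
    rw [hv i (by omega), h.len_hi i (by omega) hil]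
  · intro i hi
    by_cases c : i = j
    · subst c
      rw [hvj, hv _ (by omega)]
      exact hy.below _ (by omega) hi
    · rw [hv i c]
      by_cases c' : i + 1 = j
      · rw [c', hvj]
        exact hy.above i (by omega)
      · rw [hv _ c']
        exact h.step i hi
  · intro i hi
    by_cases c : i = j
    · subst c; rw [hvj]; exact hy.ge
    · rw [hv i c]; exact h.ge i hi
  · intro i hi
    by_cases c : i = j
    · subst c; rw [hvj]; exact hy.le
    · rw [hv i c]; exact h.le i hi

/-- Replacing the element of `v` just below the gap by one that fills the gap. -/
theorem Lift.pred (h : Lift k u w I l (j + 1) v) (hy : Mid u w l (j + 1) v y)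
    (hs : sigma k y = I j) : Lift k u w I l j (Function.update v j y) := by
  have hv : ∀ i, i ≠ j → Function.update v j y i = v i := fun i hi => Function.update_of_ne hi _ _
  have hvj : Function.update v j y j = y := Function.update_self _ _ _
  have hjl := h.le_l
  refine ⟨by omega, ?_, ?_, ?_, ?_, ?_, ?_⟩
  · intro i hi
    by_cases c : i = j
    · subst c; rw [hvj, hs]
    · rw [hv i c, h.sig i hi]
  · intro i hi
    rw [hv i (by omega), h.len_lo i (by omega)]
  · intro i hi hil
    by_cases c : i = j
    · subst c; rw [hvj, hy.len_eq]; rfl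
    · rw [hv i c, h.len_hi i (by omega) hil]
  · intro i hi
    by_cases c : i = j
    · subst c
      rw [hvj, hv _ (by omega)]
      exact hy.below _ (by omega) hi
    · rw [hv i c]
      by_cases c' : i + 1 = j
      · rw [c', hvj]
        exact hy.above i (by omega)
      · rw [hv _ c']
        exact h.step i hi
  · intro i hi
    by_cases c : i = j
    · subst c; rw [hvj]; exact hy.ge
    · rw [hv i c]; exact h.ge i hi
  · intro i hi
    by_cases c : i = j
    · subst c; rw [hvj]; exact hy.le
    · rw [hv i c]; exact h.le i hi

/-- If some chain has its gap further up, then the gap of `v` can be filled within the coset of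
the element above it. -/
theorem Lift.mid_of_lt (hI : GsumStrict l I) (h : Lift k u w I l j v)
    (h' : Lift k u w I l j' v') (hj : j < j') : Mid u w l j v (v' j) := by
  have hjl : j < l := by have := h'.le_l; omega
  have hle : BruhatLE (v' j) (v j) := by
    rcases Nat.eq_zero_or_pos j with rfl | hpos
    · rw [← (h'.ge 0 hjl).eq_of_len_le (by rw [h'.len_lo 0 hj]; rfl)]
      exact h.ge 0 hjl
    · obtain ⟨i, rfl⟩ : ∃ i, j = i + 1 := ⟨j - 1, by omega⟩
      have c : Cov (v' i) (v' (i + 1)) :=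
        ⟨h'.step i hjl, by rw [h'.len_lo _ hj, h'.len_lo i (by omega)]; rfl⟩
      refine c.le_of_sigma_eq (k := k) (sigma_ne hI h' h' (by omega) hjl (by omega)) ?_
        (by rw [h.sig _ hjl, h'.sig _ hjl])
      rw [← h.eq_lo hI h' (by omega) (by omega)]
      exact h.step i hjl
  refine ⟨h'.len_lo j hj, h'.ge j hjl, h'.le j hjl, ?_, fun i hi hil => hle.trans (h.mono hi hil)⟩
  intro i hi
  rw [h.eq_lo hI h' hi (hi.trans hj)]
  exact h'.mono hi.le hjl

/-- The positions of the gaps of the chains over a ridge form an interval. -/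
theorem Lift.exists_between (hI : GsumStrict l I) (h : Lift k u w I l j v)
    (h' : Lift k u w I l j' v') {i : ℕ} (hi : j ≤ i) (hi' : i ≤ j') :
    ∃ v'', Lift k u w I l i v'' := by
  induction hi with
  | refl => exact ⟨v, h⟩
  | @step i _ ih =>
    obtain ⟨v'', h''⟩ := ih (by omega)
    have hil : i < l := by have := h'.le_l; omega
    exact ⟨_, h''.succ (h''.mid_of_lt hI h' hi') hil (h'.sig i hil)⟩

/-- If `v` and `v'` have adjacent gaps, then the gap of `v'` is filled by an element of `v`. -/
theorem Lift.mid_of_succ (hI : GsumStrict l I) (hl : len w = len u + l)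
    (h : Lift k u w I l j v) (h' : Lift k u w I l (j + 1) v') : Mid u w l (j + 1) v' (v j) := by
  have hjl : j < l := h'.le_l
  have hm := h.mid_of_lt hI h' (Nat.lt_succ_self j)
  refine ⟨h.len_hi j le_rfl hjl, h.ge j hjl, h.le j hjl, ?_, ?_⟩
  · intro i hi
    rcases (Nat.lt_succ_iff.1 hi).eq_or_lt with rfl | hi
    · exact hm.below _ le_rfl hjl
    · rw [← h.eq_lo hI h' hi (by omega)]
      exact h.mono hi.le hjl
  · intro i hi hil
    rw [← h.eq_hi hI hl h' (by omega) hi hil]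
    exact h.mono (by omega) hil

/-- The elements that fill a gap lie in different cosets. -/
theorem Mid.eq_of_sigma_eq (hI : GsumStrict l I) (hl : len w = len u + l)
    (h : Lift k u w I l j v) (hy : Mid u w l j v y) (hy' : Mid u w l j v y')
    (e : sigma k y = sigma k y') : y = y' := by
  have hjl := h.le_l
  rcases Nat.eq_zero_or_pos j with rfl | hpos
  · rw [← hy.ge.eq_of_len_le (by rw [hy.len_eq]; rfl),
      ← hy'.ge.eq_of_len_le (by rw [hy'.len_eq]; rfl)]
  rcases hjl.eq_or_lt with rfl | hjl
  · rw [hy.le.eq_of_len_le (by rw [hy.len_eq, hl]), hy'.le.eq_of_len_le (by rw [hy'.len_eq, hl])]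
  have hlo := h.len_lo (j - 1) (by omega)
  have hhi := h.len_hi j le_rfl hjl
  have c1 : Cov (v (j - 1)) y := ⟨hy.above _ (by omega), by rw [hlo, hy.len_eq]; omega⟩
  have c1' : Cov (v (j - 1)) y' := ⟨hy'.above _ (by omega), by rw [hlo, hy'.len_eq]; omega⟩
  have c2 : Cov y (v j) := ⟨hy.below _ le_rfl hjl, by rw [hhi, hy.len_eq]⟩
  have c2' : Cov y' (v j) := ⟨hy'.below _ le_rfl hjl, by rw [hhi, hy'.len_eq]⟩
  by_cases hs : sigma k (v (j - 1)) = sigma k y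
  · refine c2.eq_of_sigma_eq' (k := k) ?_ c2' e.symm
    rw [← hs]
    exact sigma_ne hI h h (by omega) hjl (by omega)
  · exact c1.eq_of_sigma_eq hs c1' e.symm

/-- If filling the gap gives no new vertex, then the coset met is that of a neighbour in the
chain. -/
theorem Mid.sigma_mem (hI : GsumStrict l I) (h : Lift k u w I l j v) (hy : Mid u w l j v y)
    (hs : sigma k y ∈ (range l).image I) :
    (0 < j ∧ sigma k y = I (j - 1)) ∨ (j < l ∧ sigma k y = I j) := by
  obtain ⟨i, hi, e⟩ := mem_image.1 hs
  rw [mem_range] at hi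
  have hjl := h.le_l
  by_cases c : i < j
  · left
    refine ⟨by omega, ?_⟩
    have h1 := (hy.above (j - 1) (by omega)).gsum_le (k := k)
    rw [h.sig _ (by omega), ← e] at h1
    by_cases c' : i = j - 1
    · rw [← e, c']
    · have := hI i (j - 1) (by omega) (by omega)
      omega
  · right
    have hjl : j < l := by omega
    refine ⟨hjl, ?_⟩
    have h1 := (hy.below j le_rfl hjl).gsum_le (k := k)
    rw [h.sig _ hjl, ← e] at h1
    by_cases c' : i = j
    · rw [← e, c']
    · have := hI j i (by omega) hi
      omega

/-- Fillings of different gaps give different facets. -/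
theorem sigma_mid_ne_of_lt (h : Lift k u w I l j v) (h' : Lift k u w I l j' v')
    (hj : j < j') (hy : Mid u w l j v y)
    (hy' : Mid u w l j' v' y') (hs : sigma k y ∉ (range l).image I) :
    sigma k y ≠ sigma k y' := by
  intro e
  have hjl : j < l := by have := h'.le_l; omega
  have h1 := (hy.below j le_rfl hjl).gsum_le (k := k)
  have h2 := (hy'.above j hj).gsum_le (k := k)
  rw [h'.sig j hjl, ← h.sig j hjl, ← e] at h2
  have := (hy.below j le_rfl hjl).sigma_eq_of_gsum_le h2
  rw [this, h.sig j hjl] at hs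
  exact hs (mem_image_of_mem _ (mem_range.2 hjl))

open Classical in
/-- The elements that fill the gap of `v`. -/
noncomputable def mids (u w : S n) (l j : ℕ) (v : ℕ → S n) : Finset (S n) :=
  univ.filter (Mid u w l j v)

theorem mem_mids : y ∈ mids u w l j v ↔ Mid u w l j v y := by
  unfold mids; simp

/-- A gap at an end of the chain is filled in one way, a gap in the middle in two ways. -/
theorem card_mids (hu : BruhatLE u w) (hl : len w = len u + l) (hpos : 0 < l)
    (h : Lift k u w I l j v) :
    (mids u w l j v).card = (if 0 < j then 1 else 0) + (if j < l then 1 else 0) := by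
  have hjl := h.le_l
  rcases Nat.eq_zero_or_pos j with rfl | hj
  · rw [if_neg (lt_irrefl 0), if_pos hpos, card_eq_one]
    refine ⟨u, ?_⟩
    ext y
    rw [mem_mids, mem_singleton]
    constructor
    · intro hy
      exact (hy.ge.eq_of_len_le (by rw [hy.len_eq]; rfl)).symm
    · rintro rfl
      exact ⟨rfl, .refl _, hu, fun i hi => absurd hi (Nat.not_lt_zero i),
        fun i _ hil => h.ge i hil⟩
  rcases hjl.eq_or_lt with rfl | hjl
  · rw [if_neg (lt_irrefl j), if_pos hpos, card_eq_one]
    refine ⟨w, ?_⟩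
    ext y
    rw [mem_mids, mem_singleton]
    constructor
    · intro hy
      exact hy.le.eq_of_len_le (by rw [hy.len_eq, hl])
    · rintro rfl
      exact ⟨hl, hu, .refl _, fun i hi => h.le i hi, fun i hi hil => absurd hi (not_le.2 hil)⟩
  · rw [if_pos hj, if_pos hjl, card_eq_two]
    have hlo := h.len_lo (j - 1) (by omega)
    have hhi := h.len_hi j le_rfl hjl
    obtain ⟨y, y', hne, c1, c2, c1', c2', hall⟩ := exists_two_between
      (h.mono (Nat.sub_le j 1) hjl) (by rw [hlo, hhi]; omega)
    refine ⟨y, y', hne, ?_⟩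
    have mk : ∀ z, Cov (v (j - 1)) z → Cov z (v j) → Mid u w l j v z := by
      intro z h1 h2
      refine ⟨by rw [h1.2, hlo]; omega, (h.ge _ (by omega)).trans h1.1, h2.1.trans (h.le j hjl),
        fun i hi => (h.mono (by omega) (by omega)).trans h1.1,
        fun i hi hil => h2.1.trans (h.mono hi hil)⟩
    ext z
    rw [mem_mids, mem_insert, mem_singleton]
    constructor
    · intro hz
      exact hall z ⟨hz.above _ (by omega), by rw [hlo, hz.len_eq]; omega⟩
        ⟨hz.below _ le_rfl hjl, by rw [hhi, hz.len_eq]⟩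
    · rintro (rfl | rfl)
      · exact mk _ c1 c2
      · exact mk _ c1' c2'

open Classical in
/-- The elements that fill the gap of `v` and give a new vertex, counted by discarding the ones
whose coset is that of a neighbour in the chain; these correspond to chains with adjacent gaps. -/
theorem card_mids_filter (hI : GsumStrict l I) (hu : BruhatLE u w) (hl : len w = len u + l)
    (hpos : 0 < l) (h : Lift k u w I l j v) :
    ((mids u w l j v).filter fun y => sigma k y ∉ (range l).image I).card +
        (if 0 < j ∧ ∃ v', Lift k u w I l (j - 1) v' then 1 else 0) +
        (if ∃ v', Lift k u w I l (j + 1) v' then 1 else 0) =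
      (if 0 < j then 1 else 0) + (if j < l then 1 else 0) := by
  rw [← card_mids hu hl hpos h]
  have hjl := h.le_l
  set M := mids u w l j v
  have hlow : (M.filter fun y => 0 < j ∧ sigma k y = I (j - 1)).card =
      if 0 < j ∧ ∃ v', Lift k u w I l (j - 1) v' then 1 else 0 := by
    split_ifs with c
    · obtain ⟨hj, v', h'⟩ := c
      obtain ⟨i, rfl⟩ : ∃ i, j = i + 1 := ⟨j - 1, by omega⟩
      have hm := h'.mid_of_succ hI hl h
      rw [card_eq_one]
      refine ⟨v' i, ?_⟩
      ext y
      rw [mem_filter, mem_singleton, mem_mids]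
      constructor
      · rintro ⟨hy, -, e⟩
        exact hy.eq_of_sigma_eq hI hl h hm (by rw [e]; exact (h'.sig i hjl).symm)
      · rintro rfl
        exact ⟨hm, hj, h'.sig i hjl⟩
    · rw [card_eq_zero, filter_eq_empty_iff]
      rintro y hy ⟨hj, e⟩
      obtain ⟨i, rfl⟩ : ∃ i, j = i + 1 := ⟨j - 1, by omega⟩
      exact c ⟨hj, _, h.pred (mem_mids.1 hy) e⟩
  have hhigh : (M.filter fun y => j < l ∧ sigma k y = I j).card =
      if ∃ v', Lift k u w I l (j + 1) v' then 1 else 0 := by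
    split_ifs with c
    · obtain ⟨v', h'⟩ := c
      have hjl : j < l := h'.le_l
      have hm := h.mid_of_lt hI h' (Nat.lt_succ_self j)
      rw [card_eq_one]
      refine ⟨v' j, ?_⟩
      ext y
      rw [mem_filter, mem_singleton, mem_mids]
      constructor
      · rintro ⟨hy, -, e⟩
        exact hy.eq_of_sigma_eq hI hl h hm (by rw [e]; exact (h'.sig j hjl).symm)
      · rintro rfl
        exact ⟨hm, hjl, h'.sig j hjl⟩
    · rw [card_eq_zero, filter_eq_empty_iff]
      rintro y hy ⟨hj, e⟩
      exact c ⟨_, h.succ (mem_mids.1 hy) hj e⟩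
  rw [← hlow, ← hhigh, add_assoc, ← card_union_of_disjoint,
    ← card_filter_add_card_filter_not (s := M) (fun y => sigma k y ∉ (range l).image I)]
  · congr 2
    ext y
    simp only [mem_union, mem_filter, not_not]
    constructor
    · rintro (⟨hy, hj, e⟩ | ⟨hy, hj, e⟩)
      · exact ⟨hy, by rw [e]; exact mem_image_of_mem _ (mem_range.2 (by omega))⟩
      · exact ⟨hy, by rw [e]; exact mem_image_of_mem _ (mem_range.2 hj)⟩
    · rintro ⟨hy, hs⟩
      rcases (mem_mids.1 hy).sigma_mem hI h hs with c | c
      · exact Or.inl ⟨hy, c⟩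
      · exact Or.inr ⟨hy, c⟩
  · rw [disjoint_left]
    intro y hy hy'
    obtain ⟨-, hj, e⟩ := mem_filter.1 hy
    obtain ⟨-, hj', e'⟩ := mem_filter.1 hy'
    have := hI.injOn (i := j - 1) (i' := j) (by omega) hj' (by rw [← e, ← e'])
    omega

end

/-! ### Counting the facets over a ridge -/

section

variable {u w : S n} {I : ℕ → Finset (Fin n)} {l j j' : ℕ} {v v' : ℕ → S n} {y y' : S n}

/-- A chain with `l` elements in an interval of rank `l` that projects injectively, listed by
length. -/
theorem exists_lift_of_chain (hl : len w = len u + l) {C : Finset (S n)}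
    (h1 : ∀ v ∈ C, BruhatLE u v ∧ BruhatLE v w)
    (h2 : ∀ v ∈ C, ∀ v' ∈ C, v ≠ v' → BruhatLE v v' ∨ BruhatLE v' v) (hc : C.card = l)
    (hinj : Set.InjOn (sigma k) (C : Set (S n))) :
    ∃ (j : ℕ) (v : ℕ → S n), Lift k u w (fun i => sigma k (v i)) l j v ∧
      GsumStrict l (fun i => sigma k (v i)) ∧ (range l).image v = C := by
  classical
  have hcmp : ∀ v ∈ C, ∀ v' ∈ C, len v ≤ len v' → BruhatLE v v' := by
    intro v hv v' hv' hlen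
    by_cases e : v = v'
    · rw [e]; exact .refl _
    rcases h2 v hv v' hv' e with h | h
    · exact h
    · exact absurd (h.eq_of_len_le hlen).symm e
  have hlinj : Set.InjOn len (C : Set (S n)) := fun v hv v' hv' e =>
    (hcmp v hv v' hv' e.le).eq_of_len_le e.ge
  have hsub : C.image len ⊆ Icc (len u) (len w) := by
    intro t ht
    obtain ⟨v, hv, rfl⟩ := mem_image.1 ht
    exact mem_Icc.2 ⟨(h1 v hv).1.len_le, (h1 v hv).2.len_le⟩
  have hcard : (C.image len).card = l := by rw [card_image_of_injOn hlinj, hc]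
  -- exactly one length is missing
  obtain ⟨t, ht⟩ : ∃ t, Icc (len u) (len w) \ C.image len = {t} := by
    rw [← card_eq_one, card_sdiff_of_subset hsub, Nat.card_Icc, hcard]
    omega
  have htm : t ∈ Icc (len u) (len w) \ C.image len := by rw [ht]; exact mem_singleton_self t
  obtain ⟨htI, -⟩ := mem_sdiff.1 htm
  rw [mem_Icc] at htI
  have hex : ∀ s, len u ≤ s → s ≤ len w → s ≠ t → ∃ c ∈ C, len c = s := by
    intro s hs hs' hne
    by_contra hcon
    have : s ∈ Icc (len u) (len w) \ C.image len :=
      mem_sdiff.2 ⟨mem_Icc.2 ⟨hs, hs'⟩, fun h => hcon (by simpa using h)⟩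
    rw [ht, mem_singleton] at this
    exact hne this
  have hv : ∀ i, ∃ c, i < l → c ∈ C ∧ len c = len u + if i < t - len u then i else i + 1 := by
    intro i
    by_cases hi : i < l
    · obtain ⟨c, hc, e⟩ := hex (len u + if i < t - len u then i else i + 1) (by omega)
        (by split_ifs <;> omega) (by split_ifs <;> omega)
      exact ⟨c, fun _ => ⟨hc, e⟩⟩
    · exact ⟨u, fun h => absurd h hi⟩
  choose v hv using hv
  have hlt : ∀ i i', i < i' → i' < l → len (v i) < len (v i') := by
    intro i i' hi hi'
    rw [(hv i (hi.trans hi')).2, (hv i' hi').2]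
    split_ifs <;> omega
  have hvne : ∀ i i', i < i' → i' < l → v i ≠ v i' := by
    intro i i' hi hi' e
    have := hlt i i' hi hi'
    rw [e] at this
    omega
  refine ⟨t - len u, v, ⟨by omega, fun _ _ => rfl, ?_, ?_, ?_, ?_, ?_⟩, ?_, ?_⟩
  · intro i hi
    rw [(hv i (by omega)).2, if_pos hi]
  · intro i hi hil
    rw [(hv i hil).2, if_neg (not_lt.2 hi), add_assoc]
  · intro i hi
    exact hcmp _ (hv i (by omega)).1 _ (hv _ hi).1 (hlt i (i + 1) (by omega) hi).le
  · intro i hi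
    exact (h1 _ (hv i hi).1).1
  · intro i hi
    exact (h1 _ (hv i hi).1).2
  · intro i i' hi hi'
    have hm := (hv i (hi.trans hi')).1
    have hm' := (hv i' hi').1
    rcases (hcmp _ hm _ hm' (hlt i i' hi hi').le).sigma_eq_or_gsum_lt (k := k) with e | e
    · exact absurd (hinj hm hm' e) (hvne i i' hi hi')
    · exact e
  · apply eq_of_subset_of_card_le
    · intro c hcm
      obtain ⟨i, hi, rfl⟩ := mem_image.1 hcm
      exact (hv i (mem_range.1 hi)).1
    · rw [hc, card_image_of_injOn, card_range]
      intro i hi i' hi' e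
      rw [mem_coe, mem_range] at hi hi'
      rcases lt_trichotomy i i' with c | c | c
      · exact absurd e (hvne _ _ c hi')
      · exact c
      · exact absurd e.symm (hvne _ _ c hi)

/-- A face is the image of a chain with as many elements as the face has vertices. -/
theorem exists_chain_injOn {F : Finset (Finset (Fin n))} (hF : F ∈ sigmaComplex k u w) :
    ∃ C : Finset (S n), (∀ v ∈ C, BruhatLE u v ∧ BruhatLE v w) ∧
      (∀ v ∈ C, ∀ v' ∈ C, v ≠ v' → BruhatLE v v' ∨ BruhatLE v' v) ∧
      C.image (sigma k) = F ∧ Set.InjOn (sigma k) (C : Set (S n)) ∧ C.card = F.card := by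
  classical
  obtain ⟨C, h1, h2, rfl⟩ := mem_sigmaComplex.1 hF
  obtain ⟨D, hD, hinj, hDi⟩ := exists_subset_injOn_image_eq_of_surjOn (f := sigma k) C
    (C.image (sigma k)) (by rw [coe_image]; exact Set.surjOn_image _ _)
  refine ⟨D, fun v hv => h1 v (hD hv), fun v hv v' hv' => h2 v (hD hv) v' (hD hv'), hDi, hinj, ?_⟩
  rw [← hDi, card_image_of_injOn hinj]

theorem GsumStrict.card_image (hI : GsumStrict l I) : ((range l).image I).card = l := by
  rw [card_image_of_injOn, card_range]
  intro i hi i' hi' e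
  exact hI.injOn (mem_range.1 hi) (mem_range.1 hi') (by rw [e])

theorem Lift.congr (h : Lift k u w I l j v) {I' : ℕ → Finset (Fin n)}
    (e : ∀ i < l, I i = I' i) : Lift k u w I' l j v :=
  ⟨h.le_l, fun i hi => (h.sig i hi).trans (e i hi), h.len_lo, h.len_hi, h.step, h.ge, h.le⟩

/-- Filling the gap of a chain over a ridge by an element of a new coset gives a facet. -/
theorem Lift.insert_mem_topFacesOver (hl : len w = len u + l) (hI : GsumStrict l I)
    (h : Lift k u w I l j v) (hy : Mid u w l j v y)
    (hs : sigma k y ∉ (range l).image I) :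
    insert (sigma k y) ((range l).image I) ∈ topFacesOver k u w ((range l).image I) := by
  classical
  refine ⟨mem_sigmaComplex.2 ⟨insert y ((range l).image v), ?_, ?_, ?_⟩, ?_, subset_insert _ _⟩
  · intro x hx
    rcases mem_insert.1 hx with rfl | hx
    · exact ⟨hy.ge, hy.le⟩
    · obtain ⟨i, hi, rfl⟩ := mem_image.1 hx
      exact ⟨h.ge i (mem_range.1 hi), h.le i (mem_range.1 hi)⟩
  · have key : ∀ x ∈ (range l).image v, BruhatLE x y ∨ BruhatLE y x := by
      intro x hx
      obtain ⟨i, hi, rfl⟩ := mem_image.1 hx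
      by_cases c : i < j
      · exact Or.inl (hy.above i c)
      · exact Or.inr (hy.below i (not_lt.1 c) (mem_range.1 hi))
    intro x hx x' hx' hne
    rcases mem_insert.1 hx with e | hx1 <;> rcases mem_insert.1 hx' with e' | hx1'
    · exact absurd (e.trans e'.symm) hne
    · rw [e]; exact (key x' hx1').symm
    · rw [e']; exact key x hx1
    · obtain ⟨i, hi, rfl⟩ := mem_image.1 hx1
      obtain ⟨i', hi', rfl⟩ := mem_image.1 hx1'
      rcases le_total i i' with c | c
      · exact Or.inl (h.mono c (mem_range.1 hi'))
      · exact Or.inr (h.mono c (mem_range.1 hi))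
  · rw [image_insert, image_image]
    congr 1
    exact image_congr fun i hi => h.sig i (mem_range.1 hi)
  · unfold dim
    rw [card_insert_of_notMem hs, hI.card_image, hl]
    push_cast
    ring

/-- Conversely, every facet over a ridge comes from filling the gap of a chain over the ridge. -/
theorem exists_lift_of_mem_topFacesOver (hl : len w = len u + l) (hI : GsumStrict l I)
    {G : Finset (Finset (Fin n))} (hG : G ∈ topFacesOver k u w ((range l).image I)) :
    ∃ j v y, Lift k u w I l j v ∧ Mid u w l j v y ∧ sigma k y ∉ (range l).image I ∧
      G = insert (sigma k y) ((range l).image I) := by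
  classical
  obtain ⟨hG, hdim, hFG⟩ := hG
  obtain ⟨C, h1, h2, hCi, hinj, hcard⟩ := exists_chain_injOn hG
  have hGc : G.card = l + 1 := by
    unfold dim at hdim
    rw [hl] at hdim
    push_cast at hdim
    omega
  obtain ⟨K, hK⟩ : ∃ K, G \ (range l).image I = {K} := by
    rw [← card_eq_one, card_sdiff_of_subset hFG, hI.card_image, hGc]
    omega
  have hKm : K ∈ G \ (range l).image I := by rw [hK]; exact mem_singleton_self K
  obtain ⟨hKG, hKF⟩ := mem_sdiff.1 hKm
  have hGeq : G = insert K ((range l).image I) := by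
    rw [← sdiff_union_of_subset hFG, hK]; rfl
  rw [← hCi] at hKG
  obtain ⟨x, hx, rfl⟩ := mem_image.1 hKG
  obtain ⟨j, v, hv, hstrict, himg⟩ := exists_lift_of_chain (k := k) (l := l) hl (C := C.erase x)
    (fun v hv => h1 v (mem_of_mem_erase hv))
    (fun v hv v' hv' => h2 v (mem_of_mem_erase hv) v' (mem_of_mem_erase hv'))
    (by rw [card_erase_of_mem hx, hcard, hGc]; rfl)
    (hinj.mono fun v hv => mem_of_mem_erase hv)
  have himg' : (range l).image (fun i => sigma k (v i)) = (range l).image I := by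
    have e1 : (range l).image (fun i => sigma k (v i)) = (C.erase x).image (sigma k) := by
      rw [← himg, image_image]; rfl
    rw [e1, ← erase_insert hKF, ← hGeq, ← hCi]
    ext L
    simp only [mem_image, mem_erase]
    constructor
    · rintro ⟨c, ⟨hne, hc⟩, rfl⟩
      exact ⟨fun e => hne (hinj hc hx e), c, hc, rfl⟩
    · rintro ⟨hne, c, hc, rfl⟩
      exact ⟨c, ⟨fun e => hne (by rw [e]), hc⟩, rfl⟩
  have hvI := hv.congr fun i hi => hstrict.eq_of_image_eq hI himg' hi
  have hvC : ∀ i < l, v i ∈ C ∧ v i ≠ x := by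
    intro i hi
    have : v i ∈ C.erase x := by rw [← himg]; exact mem_image_of_mem _ (mem_range.2 hi)
    exact ⟨mem_of_mem_erase this, ne_of_mem_erase this⟩
  have hcmp : ∀ i < l, BruhatLE (v i) x ∨ BruhatLE x (v i) := fun i hi =>
    h2 _ (hvC i hi).1 x hx (hvC i hi).2
  have hne : ∀ i < l, len (v i) ≠ len x := by
    intro i hi e
    rcases hcmp i hi with h | h
    · exact (hvC i hi).2 (h.eq_of_len_le e.ge)
    · exact (hvC i hi).2 (h.eq_of_len_le e.le).symm
  have hxu := (h1 x hx).1.len_le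
  have hxw := (h1 x hx).2.len_le
  have hjl := hv.le_l
  have hlen : len x = len u + j := by
    by_contra hc
    rcases lt_or_gt_of_ne hc with c | c
    · exact hne (len x - len u) (by omega) (by rw [hv.len_lo _ (by omega)]; omega)
    · exact hne (len x - len u - 1) (by omega)
        (by rw [hv.len_hi _ (by omega) (by omega)]; omega)
  refine ⟨j, v, x, hvI, ⟨hlen, (h1 x hx).1, (h1 x hx).2, ?_, ?_⟩, hKF, hGeq⟩
  · intro i hi
    rcases hcmp i (by omega) with h | h
    · exact h
    · have := h.len_le
      rw [hv.len_lo i hi] at this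
      omega
  · intro i hi hil
    rcases hcmp i hil with h | h
    · have := h.len_le
      rw [hv.len_hi i hi hil] at this
      omega
    · exact h

open Classical in
/-- The gaps of the chains over a ridge form an interval `[q, p]`; each of its two ends
contributes one facet, unless it is an end of `[0, l]`. -/
theorem exists_ncard_topFacesOver (hu : BruhatLE u w) (hl : len w = len u + l) (hpos : 0 < l)
    (hI : GsumStrict l I) (hex : ∃ j v, Lift k u w I l j v) :
    ∃ q p, q ≤ p ∧ p ≤ l ∧ (∀ j, (∃ v, Lift k u w I l j v) ↔ q ≤ j ∧ j ≤ p) ∧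
      (topFacesOver k u w ((range l).image I)).ncard =
        (if 0 < q then 1 else 0) + (if p < l then 1 else 0) := by
  let J : Finset ℕ := (range (l + 1)).filter fun j => ∃ v, Lift k u w I l j v
  have hJ : ∀ j, j ∈ J ↔ ∃ v, Lift k u w I l j v := by
    intro j
    simp only [J, mem_filter, mem_range, and_iff_right_iff_imp]
    rintro ⟨v, h⟩
    exact Nat.lt_succ_of_le h.le_l
  have hne : J.Nonempty := by
    obtain ⟨j, hj⟩ := hex
    exact ⟨j, (hJ j).2 hj⟩
  set q := J.min' hne with hq
  set p := J.max' hne with hp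
  obtain ⟨vq, hvq⟩ := (hJ q).1 (J.min'_mem hne)
  obtain ⟨vp, hvp⟩ := (hJ p).1 (J.max'_mem hne)
  have hqp : q ≤ p := J.min'_le _ (J.max'_mem hne)
  have hiff : ∀ j, (∃ v, Lift k u w I l j v) ↔ q ≤ j ∧ j ≤ p := by
    intro j
    constructor
    · intro h
      exact ⟨J.min'_le _ ((hJ j).2 h), J.le_max' _ ((hJ j).2 h)⟩
    · rintro ⟨h1, h2⟩
      exact hvq.exists_between hI hvp h1 h2
  refine ⟨q, p, hqp, hvp.le_l, hiff, ?_⟩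
  have hV : ∀ j, ∃ v, q ≤ j ∧ j ≤ p → Lift k u w I l j v := by
    intro j
    by_cases h : q ≤ j ∧ j ≤ p
    · obtain ⟨v, hv⟩ := (hiff j).2 h
      exact ⟨v, fun _ => hv⟩
    · exact ⟨fun _ => u, fun h' => absurd h' h⟩
  choose V hV using hV
  set F := (range l).image I with hF
  let M : ℕ → Finset (S n) := fun j => (mids u w l j (V j)).filter fun y => sigma k y ∉ F
  let N : ℕ → Finset (Finset (Finset (Fin n))) := fun j =>
    (M j).image fun y => insert (sigma k y) F
  have hM : ∀ j y, y ∈ M j ↔ Mid u w l j (V j) y ∧ sigma k y ∉ F := by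
    intro j y
    simp only [M, mem_filter, mem_mids]
  have hinsert : ∀ {K K' : Finset (Fin n)}, K ∉ F → insert K F = insert K' F → K = K' := by
    intro K K' hK e
    have : K ∈ insert K' F := by rw [← e]; exact mem_insert_self _ _
    exact (mem_insert.1 this).resolve_right hK
  have hT : topFacesOver k u w F = ((Icc q p).biUnion N : Finset (Finset (Finset (Fin n)))) := by
    ext G
    simp only [coe_biUnion, Set.mem_iUnion, coe_Icc, Set.mem_Icc, N, mem_coe, mem_image,
      exists_prop]
    constructor
    · intro hG
      obtain ⟨j, v, y, hv, hy, hs, rfl⟩ := exists_lift_of_mem_topFacesOver hl hI hG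
      have hj := (hiff j).1 ⟨v, hv⟩
      exact ⟨j, hj, y, (hM j y).2 ⟨hy.congr hv.le_l fun i hi => hv.eq hI hl (hV j hj) hi, hs⟩, rfl⟩
    · rintro ⟨j, hj, y, hy, rfl⟩
      obtain ⟨hy, hs⟩ := (hM j y).1 hy
      exact (hV j hj).insert_mem_topFacesOver hl hI hy hs
  have hN : ∀ j ∈ Icc q p, (N j).card = (if j = q then if 0 < q then 1 else 0 else 0) +
      (if j = p then if p < l then 1 else 0 else 0) := by
    intro j hj
    rw [mem_Icc] at hj
    have hv := hV j hj
    have hpl := hvp.le_l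
    have h1 := card_mids_filter hI hu hl hpos hv
    have h2 : (N j).card = (M j).card := by
      apply card_image_of_injOn
      intro y hy y' hy' e
      obtain ⟨hy, hs⟩ := (hM j y).1 hy
      obtain ⟨hy', -⟩ := (hM j y').1 hy'
      exact hy.eq_of_sigma_eq hI hl hv hy' (hinsert hs e)
    rw [h2]
    change (M j).card + _ + _ = _ at h1
    simp only [hiff] at h1
    split_ifs at h1 ⊢ <;> omega
  rw [hT, Set.ncard_coe_finset, card_biUnion, sum_congr rfl hN, sum_add_distrib, sum_ite_eq',
    sum_ite_eq', if_pos (mem_Icc.2 ⟨le_rfl, hqp⟩), if_pos (mem_Icc.2 ⟨hqp, le_rfl⟩)]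
  have hdisj : ∀ i j, i < j → i ∈ Icc q p → j ∈ Icc q p → Disjoint (N i) (N j) := by
    intro i j hij hi hj
    rw [mem_Icc] at hi hj
    rw [disjoint_left]
    intro G hG hG'
    obtain ⟨y, hy, rfl⟩ := mem_image.1 hG
    obtain ⟨y', hy', e⟩ := mem_image.1 hG'
    obtain ⟨hy, hs⟩ := (hM i y).1 hy
    obtain ⟨hy', hs'⟩ := (hM j y').1 hy'
    exact sigma_mid_ne_of_lt (hV i hi) (hV j hj) hij hy hy' hs (hinsert hs' e).symm
  intro i hi j hj hne
  rcases lt_or_gt_of_ne hne with c | c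
  · exact hdisj i j c hi hj
  · exact (hdisj j i c hj hi).symm

end

/-! ### Ridges when the upper end is Grassmannian -/

section

variable {u w : S n} {F : Finset (Finset (Fin n))}

/-- A face with the number of vertices of a ridge, as an increasing sequence of cosets with a chain
over it. -/
theorem exists_lift_of_card {u' w' : S n} (hu : BruhatLE u u') (hw : BruhatLE w' w)
    (hl : len w = len u + F.card) (hF : F ∈ sigmaComplex k u' w') :
    ∃ I : ℕ → Finset (Fin n), GsumStrict F.card I ∧ (range F.card).image I = F ∧
      ∃ j v, Lift k u w I F.card j v ∧ ∀ i < F.card, BruhatLE u' (v i) ∧ BruhatLE (v i) w' := by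
  classical
  obtain ⟨C, h1, h2, hCi, hinj, hcard⟩ := exists_chain_injOn hF
  obtain ⟨j, v, hv, hstrict, himg⟩ := exists_lift_of_chain (k := k) hl
    (fun v hv => ⟨hu.trans (h1 v hv).1, (h1 v hv).2.trans hw⟩) h2 hcard hinj
  refine ⟨_, hstrict, ?_, j, v, hv, ?_⟩
  · calc _ = ((range F.card).image v).image (sigma k) := by rw [image_image]; rfl
      _ = F := by rw [himg, hCi]
  · intro i hi
    apply h1
    rw [← himg]
    exact mem_image_of_mem _ (mem_range.2 hi)

/-- When `u = w`, the only ridge is the empty face and the only facet is the point `σ_k(u)`. -/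
theorem ncard_topFacesOver_of_card_eq_zero (hu : BruhatLE u w) (hl : len w = len u)
    (hF : F.card = 0) : (topFacesOver k u w F).ncard = 1 := by
  obtain rfl := hu.eq_of_len_le hl.le
  rw [card_eq_zero] at hF
  subst hF
  rw [Set.ncard_eq_one]
  refine ⟨{sigma k u}, ?_⟩
  ext G
  simp only [topFacesOver, Set.mem_ofPred_eq, sub_self, empty_subset, and_true,
    Set.mem_singleton_iff, dim]
  constructor
  · rintro ⟨hG, hd⟩
    obtain ⟨C, h1, -, rfl⟩ := mem_sigmaComplex.1 hG
    apply eq_of_subset_of_card_le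
    · intro K hK
      obtain ⟨v, hv, rfl⟩ := mem_image.1 hK
      rw [mem_singleton, (h1 v hv).1.antisymm (h1 v hv).2]
    · rw [card_singleton]; omega
  · rintro rfl
    refine ⟨mem_sigmaComplex.2 ⟨{u}, ?_, ?_, image_singleton _ _⟩, by simp⟩
    · intro v hv
      rw [mem_singleton.1 hv]
      exact ⟨.refl _, .refl _⟩
    · intro v hv v' hv' hne
      exact absurd ((mem_singleton.1 hv).trans (mem_singleton.1 hv').symm) hne

/-- For Grassmannian `w` the gaps of the chains over a ridge do not reach both ends: a chain with
gap `l - 1` ends in `w`, one with gap `l` ends in a smaller element of the coset of `w`. -/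
theorem IsGrass.not_both_ends (hw : IsGrass k w) {I : ℕ → Finset (Fin n)} {l : ℕ}
    (hl : len w = len u + l) (hpos : 0 < l) (hI : GsumStrict l I)
    {v v' : ℕ → S n} (h : Lift k u w I l 0 v) (h' : Lift k u w I l l v') : False := by
  obtain ⟨v'', h''⟩ := h.exists_between hI h' (Nat.zero_le (l - 1)) (Nat.sub_le l 1)
  have h1 := h''.len_hi (l - 1) le_rfl (by omega)
  have h2 := (h''.le (l - 1) (by omega)).eq_of_len_le (by omega)
  have h3 := h'.len_lo (l - 1) (by omega)
  have h4 := hw _ (h'.le (l - 1) (by omega))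
    (by rw [← h2, h'.sig _ (by omega), h''.sig _ (by omega)])
  rw [h4] at h3
  omega

theorem IsGrass.ncard_topFacesOver (hw : IsGrass k w) (hu : BruhatLE u w)
    (hl : len w = len u + F.card) (hF : F ∈ sigmaComplex k u w) :
    (topFacesOver k u w F).ncard = 1 ∨ (topFacesOver k u w F).ncard = 2 := by
  rcases Nat.eq_zero_or_pos F.card with h0 | hpos
  · exact Or.inl (ncard_topFacesOver_of_card_eq_zero hu (by omega) h0)
  obtain ⟨I, hI, hIF, j, v, hv, -⟩ := exists_lift_of_card (.refl _) (.refl _) hl hF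
  obtain ⟨q, p, hqp, hpl, hiff, hcard⟩ := exists_ncard_topFacesOver hu hl hpos hI ⟨j, v, hv⟩
  rw [hIF] at hcard
  rw [hcard]
  have : ¬ (q = 0 ∧ p = F.card) := by
    rintro ⟨rfl, rfl⟩
    obtain ⟨v1, hv1⟩ := (hiff 0).2 ⟨le_rfl, hqp⟩
    obtain ⟨v2, hv2⟩ := (hiff F.card).2 ⟨hqp, le_rfl⟩
    exact hw.not_both_ends hl hpos hI hv1 hv2
  split_ifs <;> omega

/-- `F` is the image of a chain in a proper subinterval of `[u,w]`. -/
def IsProperFace (k : ℕ) (u w : S n) (F : Finset (Finset (Fin n))) : Prop :=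
  ∃ u' w', BruhatLE u u' ∧ BruhatLE u' w' ∧ BruhatLE w' w ∧ (u' ≠ u ∨ w' ≠ w) ∧
    F ∈ sigmaComplex k u' w'

/-- A ridge that comes from a proper subinterval is exterior: one of its chains has its gap at an
end. -/
theorem IsGrass.ncard_topFacesOver_of_isProperFace (hw : IsGrass k w)
    (hl : len w = len u + F.card) (hF : IsProperFace k u w F) :
    (topFacesOver k u w F).ncard = 1 := by
  obtain ⟨u', w', hu', huw', hw', hne, hF⟩ := hF
  have hu : BruhatLE u w := hu'.trans (huw'.trans hw')
  rcases Nat.eq_zero_or_pos F.card with h0 | hpos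
  · exact ncard_topFacesOver_of_card_eq_zero hu (by omega) h0
  obtain ⟨I, hI, hIF, j, v, hv, hsub⟩ := exists_lift_of_card hu' hw' hl hF
  obtain ⟨q, p, hqp, hpl, hiff, hcard⟩ := exists_ncard_topFacesOver hu hl hpos hI ⟨j, v, hv⟩
  rw [hIF] at hcard
  rw [hcard]
  have h1 : ¬ (q = 0 ∧ p = F.card) := by
    rintro ⟨rfl, rfl⟩
    obtain ⟨v1, hv1⟩ := (hiff 0).2 ⟨le_rfl, hqp⟩
    obtain ⟨v2, hv2⟩ := (hiff F.card).2 ⟨hqp, le_rfl⟩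
    exact hw.not_both_ends hl hpos hI hv1 hv2
  have hj := (hiff j).1 ⟨v, hv⟩
  have hjl := hv.le_l
  -- the chain misses the lowest or the highest length
  have h2 : j = 0 ∨ j = F.card := by
    by_contra hc
    rcases hne with hne | hne
    · have h3 := hu'.len_lt hne.symm
      have h4 := (hsub 0 hpos).1.len_le
      rw [hv.len_lo 0 (by omega)] at h4
      omega
    · have h3 := hw'.len_lt hne
      have h4 := (hsub (F.card - 1) (by omega)).2.len_le
      rw [hv.len_hi (F.card - 1) (by omega) (by omega)] at h4
      omega
  split_ifs <;> omega

/-- For Grassmannian `w`, every face that comes from a proper subinterval lies in a ridge that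
does. If only `w` is avoided, the subinterval `[u,y]` with `y` covered by `w` need not be pure,
but a maximal face of it that is not a ridge of `[u,w]` avoids `u` as well. -/
theorem IsGrass.exists_isProperFace (hw : IsGrass k w) (hF : IsProperFace k u w F) :
    ∃ R, F ⊆ R ∧ IsProperFace k u w R ∧ len w = len u + R.card := by
  have key : ∀ {x F'}, Cov u x → BruhatLE x w → F' ∈ sigmaComplex k x w →
      ∃ R, F' ⊆ R ∧ IsProperFace k u w R ∧ len w = len u + R.card := by
    intro x F' hux hxw hF'
    obtain ⟨R, hR, hFR, hcard⟩ := hw.exists_facet hxw hF'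
    refine ⟨R, hFR, ⟨x, w, hux.1, hxw, .refl _, Or.inl hux.ne.symm, hR⟩, ?_⟩
    have := hux.2
    omega
  obtain ⟨u', w', hu', huw', hw', hne, hF⟩ := hF
  by_cases hu : u' = u
  · have hww : w' ≠ w := hne.resolve_left (not_not.2 hu)
    subst hu
    obtain ⟨y, hwy, hyw⟩ := hw'.exists_cov_right hww
    have huy := huw'.trans hwy
    have hFy : F ∈ sigmaComplex k u' y := sigmaComplex_mono (.refl _) hwy hF
    obtain ⟨F', hFF', hmax⟩ := (Set.toFinite (sigmaComplex k u' y)).exists_le_maximal hFy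
    rcases card_eq_or_mem_of_maximal huy hmax.1 (fun G hG h => h.antisymm (hmax.2 hG h)) with
      hcard | ⟨x, hux, hxy, -, hFx⟩
    · refine ⟨F', hFF', ⟨u', y, .refl _, huy, hyw.1, Or.inr hyw.ne, hmax.1⟩, ?_⟩
      have := hyw.2
      omega
    · obtain ⟨R, hR, h⟩ := key hux (hxy.trans hyw.1) (sigmaComplex_mono (.refl _) hyw.1 hFx)
      exact ⟨R, Subset.trans hFF' hR, h⟩
  · obtain ⟨x, hux, hxu⟩ := hu'.exists_cov_left (Ne.symm hu)
    exact key hux (hxu.trans (huw'.trans hw')) (sigmaComplex_mono hxu hw' hF)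

end

/-! ### Invariance under the equivalence relation -/

/-- A monotone self-map of Bruhat order that preserves cosets carries chains to chains with the same
image. -/
theorem map_mem_sigmaComplex {u w : S n} {F : Finset (Finset (Fin n))} (f : S n → S n)
    (hf : ∀ x y, BruhatLE x y → BruhatLE (f x) (f y)) (hs : ∀ x, sigma k (f x) = sigma k x)
    (hF : F ∈ sigmaComplex k u w) : F ∈ sigmaComplex k (f u) (f w) := by
  classical
  rw [mem_sigmaComplex] at hF ⊢
  obtain ⟨C, h1, h2, rfl⟩ := hF
  refine ⟨C.image f, ?_, ?_, ?_⟩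
  · intro x hx
    obtain ⟨v, hv, rfl⟩ := mem_image.1 hx
    exact ⟨hf _ _ (h1 v hv).1, hf _ _ (h1 v hv).2⟩
  · intro x hx x' hx' hne
    obtain ⟨v, hv, rfl⟩ := mem_image.1 hx
    obtain ⟨v', hv', rfl⟩ := mem_image.1 hx'
    exact (h2 v hv v' hv' fun e => hne (by rw [e])).imp (hf _ _) (hf _ _)
  · rw [image_image]
    exact image_congr fun v _ => hs v

section Simple

variable {a b : Fin n}

theorem sigma_up (hk : a.val < k ↔ b.val < k) (u : S n) : sigma k (up a b u) = sigma k u := by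
  unfold up
  split_ifs
  · exact sigma_mul_swap hk
  · rfl

theorem sigma_dn (hk : a.val < k ↔ b.val < k) (u : S n) : sigma k (dn a b u) = sigma k u := by
  unfold dn
  split_ifs
  · rfl
  · exact sigma_mul_swap hk

theorem dn_mem_sigmaComplex (hab : b.val = a.val + 1) (hk : a.val < k ↔ b.val < k) {u w : S n}
    {F : Finset (Finset (Fin n))} (hF : F ∈ sigmaComplex k u w) :
    F ∈ sigmaComplex k (dn a b u) (dn a b w) :=
  map_mem_sigmaComplex _ (fun _ _ => dn_mono hab) (sigma_dn hk) hF

theorem sigmaComplex_mul_simple (hab : b.val = a.val + 1) (hk : a.val < k ↔ b.val < k) {u w : S n}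
    (hu : u b < u a) (hw : w b < w a) :
    sigmaComplex k (u * Equiv.swap a b) (w * Equiv.swap a b) = sigmaComplex k u w := by
  ext F
  constructor
  · intro hF
    have := map_mem_sigmaComplex _ (fun _ _ => up_mono hab) (sigma_up hk) hF
    rwa [up_mul_simple hab, up_mul_simple hab, up_of_gt hu, up_of_gt hw] at this
  · intro hF
    have := dn_mem_sigmaComplex hab hk hF
    rwa [dn_of_gt hu, dn_of_gt hw] at this

end Simple

/-- A length-additive right multiplication by a parabolic element does not change the complex: it
is a sequence of multiplications by adjacent transpositions inside a block. -/
theorem sigmaComplex_mul_of_parabolic {z : S n} (hz : IsParabolic k z) {u w : S n}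
    (hu : len (u * z) = len u + len z) (hw : len (w * z) = len w + len z) :
    sigmaComplex k (u * z) (w * z) = sigmaComplex k u w := by
  induction hm : len z generalizing z with
  | zero => rw [eq_one_of_len_eq_zero hm, mul_one, mul_one]
  | succ m ih =>
    obtain ⟨a, b, hab, h⟩ := exists_descent_of_len_pos (u := z) (by omega)
    have hk : a.val < k ↔ b.val < k := by
      have h1 := hz a
      have h2 := hz b
      rw [Fin.lt_def] at h
      omega
    have hlz := len_mul_simple_of_gt hab h
    have hdesc : ∀ x : S n, len (x * z) = len x + len z →
        (x * z) b < (x * z) a ∧ len (x * (z * Equiv.swap a b)) = len x + m := by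
      intro x hx
      have h1 := len_mul_le x (z * Equiv.swap a b)
      rw [← mul_assoc] at h1 ⊢
      by_cases hc : (x * z) a < (x * z) b
      · have := len_mul_simple hab hc
        omega
      · rw [not_apply_lt_iff hab] at hc
        have := len_mul_simple_of_gt hab hc
        exact ⟨hc, by omega⟩
    have hz' : IsParabolic k (z * Equiv.swap a b) := by
      intro i
      rw [Equiv.Perm.mul_apply, hz, Equiv.swap_apply_def]
      split_ifs with h1 h2
      · rw [h1]; exact hk.symm
      · rw [h2]; exact hk
      · rfl
    obtain ⟨hu1, hu2⟩ := hdesc u hu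
    obtain ⟨hw1, hw2⟩ := hdesc w hw
    rw [← ih hz' (by omega) (by omega) (by omega), ← mul_assoc, ← mul_assoc]
    exact (sigmaComplex_mul_simple hab hk hu1 hw1).symm

theorem KCov.cov {u v : S n} (h : KCov k u v) : Cov u v := h.1.cov

theorem KLE.le {u w : S n} (h : KLE k u w) : BruhatLE u w := by
  induction h with
  | refl => exact .refl _
  | tail _ hs ih => exact ih.trans hs.cov.1

theorem sigmaComplex_eq_of_mk_eq {u w u' w' : S n} {h : KLE k u w} {h' : KLE k u' w'}
    (e : Q.mk u w h = Q.mk u' w' h') :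
    sigmaComplex k u w = sigmaComplex k u' w' ∧ len w + len u' = len w' + len u := by
  have := Quot.eqvGen_exact e
  suffices ∀ p q : KInterval k n, Relation.EqvGen (KIntervalRel k n) p q →
      sigmaComplex k p.1.1 p.1.2 = sigmaComplex k q.1.1 q.1.2 ∧
        len p.1.2 + len q.1.1 = len q.1.2 + len p.1.1 from this _ _ ‹_›
  intro p q hpq
  induction hpq with
  | rel p q hr =>
    obtain ⟨z, hz, h1, h2, h3, h4⟩ := hr
    rw [h1] at h2
    rw [h3] at h4
    rw [h1, h3, sigmaComplex_mul_of_parabolic hz h2 h4]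
    exact ⟨rfl, by omega⟩
  | refl => exact ⟨rfl, rfl⟩
  | symm p q _ ih => exact ⟨ih.1.symm, by omega⟩
  | trans p q r _ _ ih ih' => exact ⟨ih.1.trans ih'.1, by omega⟩

/-! ### Reduction to a Grassmannian upper end -/

theorem exists_block_descent_of_not_isGrass {w : S n} (h : ¬ IsGrass k w) :
    ∃ a b : Fin n, b.val = a.val + 1 ∧ (a.val < k ↔ b.val < k) ∧ w b < w a := by
  unfold IsGrass at h
  push Not at h
  obtain ⟨y, hyw, hs, hne⟩ := h
  rcases Relation.ReflTransGen.cases_tail hyw with e | ⟨z, hyz, hzw⟩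
  · exact absurd e.symm hne
  rcases hzw.sigma_cases (k := k) with ⟨i, j, hij, hz, rfl, hk, -⟩ | ⟨_, _, _, _, _, _, _, hg⟩
  · obtain ⟨a, b, hab, hia, hbj, hd⟩ := exists_adjacent_descent (u := z * Equiv.swap i j) hij
      (by simpa using hz)
    rw [Fin.le_def] at hia hbj
    exact ⟨a, b, hab, by omega, hd⟩
  · have := BruhatLE.gsum_le (k := k) hyz
    rw [hs] at this
    omega

/-- Descents inside a block are inherited downwards in `k`-Bruhat order. -/
theorem chain_mul_simple {a b : Fin n} (hab : b.val = a.val + 1) (hk : a.val < k ↔ b.val < k)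
    {u w : S n} (h : Relation.ReflTransGen (fun x y => Cov x y ∧ sigma k x ≠ sigma k y) u w)
    (hw : w b < w a) :
    u b < u a ∧ Relation.ReflTransGen (fun x y => Cov x y ∧ sigma k x ≠ sigma k y)
      (u * Equiv.swap a b) (w * Equiv.swap a b) := by
  induction h using Relation.ReflTransGen.head_induction_on with
  | refl => exact ⟨hw, .refl⟩
  | @head x y hxy _ ih =>
    obtain ⟨hy, hch⟩ := ih
    obtain ⟨hc, hs⟩ := hxy
    have hx : x b < x a := by
      rw [← not_apply_lt_iff hab]
      intro hx
      have h1 := up_mono hab hc.1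
      rw [up_of_lt hx, up_of_gt hy] at h1
      have h2 := len_mul_simple hab hx
      have h3 := hc.2
      rw [← h1.eq_of_len_le (by omega), sigma_mul_swap hk] at hs
      exact hs rfl
    have h1 := dn_mono hab hc.1
    rw [dn_of_gt hx, dn_of_gt hy] at h1
    have h2 := len_mul_simple_of_gt hab hx
    have h3 := len_mul_simple_of_gt hab hy
    have h4 := hc.2
    refine ⟨hx, .head ⟨⟨h1, by omega⟩, ?_⟩ hch⟩
    rwa [sigma_mul_swap hk, sigma_mul_swap hk]

theorem IsProperFace.mul_simple {a b : Fin n} (hab : b.val = a.val + 1)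
    (hk : a.val < k ↔ b.val < k) {u w : S n} (hu : u b < u a) (hw : w b < w a)
    {F : Finset (Finset (Fin n))} (hF : IsProperFace k u w F) :
    IsProperFace k (u * Equiv.swap a b) (w * Equiv.swap a b) F := by
  obtain ⟨u', w', hu', huw', hw', hne, hF⟩ := hF
  have h1 := dn_mono hab hu'
  have h2 := dn_mono hab huw'
  have h3 := dn_mono hab hw'
  rw [dn_of_gt hu] at h1
  rw [dn_of_gt hw] at h3
  have hdn : ∀ x y : S n, y b < y a → dn a b x = y * Equiv.swap a b →
      x = y ∨ x = y * Equiv.swap a b := by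
    intro x y _ e
    unfold dn at e
    split_ifs at e
    · exact Or.inr e
    · exact Or.inl (mul_right_cancel e)
  by_cases hd : dn a b u' = u * Equiv.swap a b ∧ dn a b w' = w * Equiv.swap a b
  · obtain ⟨e1, e2⟩ := hd
    have hl := len_mul_simple_of_gt hab hu
    have hlu := hu'.len_le
    have e1' : u' = u := by
      rcases hdn u' u hu e1 with e | e
      · exact e
      · rw [e] at hlu; omega
    have e2' : w' = w * Equiv.swap a b :=
      (hdn w' w hw e2).resolve_left (hne.resolve_left (not_not.2 e1'))
    -- the subinterval `[u, ws]` lies in `[us, ws]` and avoids `us`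
    subst e1' e2'
    refine ⟨u', _, mul_simple_le hab hu, huw', .refl _, Or.inl ?_, hF⟩
    intro e
    rw [← e] at hl
    omega
  · exact ⟨_, _, h1, h2, h3, not_and_or.1 hd, dn_mem_sigmaComplex hab hk hF⟩

/-- The reduction on which both parts rest: as long as `w` has a descent `s` inside a block, `u` has
it too, and `[u,w]` may be replaced by `[us,ws]`. -/
theorem exists_isGrass {u w : S n} (h : KLE k u w) :
    ∃ u₀ w₀, BruhatLE u₀ w₀ ∧ IsGrass k w₀ ∧ sigmaComplex k u₀ w₀ = sigmaComplex k u w ∧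
      len w₀ + len u = len w + len u₀ ∧
      ∀ F, IsProperFace k u w F → IsProperFace k u₀ w₀ F := by
  have h' : Relation.ReflTransGen (fun x y => Cov x y ∧ sigma k x ≠ sigma k y) u w :=
    Relation.ReflTransGen.mono (fun x y (hxy : KCov k x y) => ⟨hxy.cov, hxy.2⟩) _ _ h
  have hle := h.le
  clear h
  induction hm : len w using Nat.strong_induction_on generalizing u w with
  | _ m ih =>
    by_cases hg : IsGrass k w
    · exact ⟨u, w, hle, hg, rfl, by omega, fun _ h => h⟩
    obtain ⟨a, b, hab, hk, hw⟩ := exists_block_descent_of_not_isGrass hg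
    obtain ⟨hu, hch⟩ := chain_mul_simple hab hk h' hw
    have hlw := len_mul_simple_of_gt hab hw
    have hlu := len_mul_simple_of_gt hab hu
    have hle' := dn_mono hab hle
    rw [dn_of_gt hu, dn_of_gt hw] at hle'
    obtain ⟨u₀, w₀, h1, h2, h3, h4, h5⟩ := ih _ (by omega) hch hle' rfl
    exact ⟨u₀, w₀, h1, h2, h3.trans (sigmaComplex_mul_simple hab hk hu hw), by omega,
      fun F hF => h5 F (hF.mul_simple hab hk hu hw)⟩

theorem topFacesOver_congr {u w u' w' : S n} (h : sigmaComplex k u w = sigmaComplex k u' w')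
    (hl : len w + len u' = len w' + len u) (F : Finset (Finset (Fin n))) :
    topFacesOver k u w F = topFacesOver k u' w' F := by
  unfold topFacesOver
  rw [h, show (len w : ℤ) - len u = len w' - len u' by omega]

end Positroid

theorem lemmaL (k n : ℕ) (hkn : k ≤ n) (u w : Positroid.S n) (huw : Positroid.KLE k u w) :
    (∀ F : Finset (Finset (Fin n)), Positroid.IsRidge k u w F →
      Positroid.IsExteriorRidge k u w F ∨ Positroid.IsInteriorRidge k u w F) ∧
    (∀ (u' w' : Positroid.S n) (huw' : Positroid.KLE k u' w'),
      Positroid.Q.lt (Positroid.Q.mk u w huw) (Positroid.Q.mk u' w' huw') →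
      (∀ F ∈ Positroid.sigmaComplex k u' w',
        ∃ R : Finset (Finset (Fin n)), F ⊆ R ∧ Positroid.IsExteriorRidge k u w R) ∧
      (∀ F ∈ Positroid.sigmaComplex k u' w',
        Positroid.IsRidge k u w F → Positroid.IsExteriorRidge k u w F)) := by
  open Positroid in
  refine ⟨?_, ?_⟩
  · intro F hF
    obtain ⟨u₀, w₀, hle, hg, hcx, hl, -⟩ := exists_isGrass huw
    have hT := topFacesOver_congr hcx (by omega) F
    have hd := hF.2
    unfold dim at hd
    unfold IsExteriorRidge IsInteriorRidge
    rw [← hT]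
    exact (hg.ncard_topFacesOver hle (by omega) (by rw [hcx]; exact hF.1)).imp
      (fun h => ⟨hF, h⟩) (fun h => ⟨hF, h⟩)
  · intro u' w' huw' hlt
    have main : ∀ F ∈ sigmaComplex k u' w', ∃ R, F ⊆ R ∧ IsExteriorRidge k u w R := by
      intro F hF
      obtain ⟨⟨u₁, w₁, u₁', w₁', h₁, h₁', e, e', hsub⟩, hne⟩ := hlt
      obtain ⟨hcx₁, hl₁⟩ := sigmaComplex_eq_of_mk_eq e
      obtain ⟨u₀, w₀, hle, hg, hcx, hl, hproper⟩ := exists_isGrass h₁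
      have hm := hsub (show u₁' ∈ interval u₁' w₁' from ⟨.refl _, h₁'.le⟩)
      have hm' := hsub (show w₁' ∈ interval u₁' w₁' from ⟨h₁'.le, .refl _⟩)
      have hP : IsProperFace k u₁ w₁ F := by
        refine ⟨u₁', w₁', hm.1, h₁'.le, hm'.2, ?_, by rwa [(sigmaComplex_eq_of_mk_eq e').1]⟩
        by_contra hc
        push Not at hc
        obtain ⟨rfl, rfl⟩ := hc
        exact hne (e.symm.trans e')
      obtain ⟨R, hFR, hR, hcard⟩ := hg.exists_isProperFace (hproper F hP)
      refine ⟨R, hFR, ⟨?_, ?_⟩, ?_⟩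
      · rw [← hcx₁, ← hcx]
        obtain ⟨x, y, hx, -, hy, -, hRxy⟩ := hR
        exact sigmaComplex_mono hx hy hRxy
      · unfold dim
        omega
      · rw [← topFacesOver_congr (hcx.trans hcx₁) (by omega) R]
        exact hg.ncard_topFacesOver_of_isProperFace hcard hR
    refine ⟨main, ?_⟩
    intro F hF hridge
    obtain ⟨R, hFR, hR⟩ := main F hF
    -- both are ridges, so they have the same number of vertices
    have hd := hridge.2
    have hd' := hR.1.2
    unfold dim at hd hd'
    rwa [eq_of_subset_of_card_le hFR (by omega)]
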